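/- **Corollary 5.3 ($F = P + N$).** Let $\zeta$ be the Riemann zeta function and $\gamma$ Euler's constant. For real $x$ and real $\tau$ with $0<|\tau|<3$ put $$F(x,\tau)=\frac1\tau\sum_{\rho}\left[1-\left(\frac{\rho}{\rho-\tau}\right)^{x}\right],$$ where $\rho$ runs over the zeros of $\zeta$ in the strip $0<\Re(s)<1$, counted with multiplicity, the terms of $\rho$ and $1-\rho$ being paired together, and the power is the principal one. Define real numbers $\eta_k$ ($k\ge 0$) by the expansion $$\frac{\zeta'(s)}{\zeta(s)}=-\frac1{s-1}-\sum_{k=0}^{\infty}\eta_k(s-1)^k$$ around $s=1$, and for real $x$ and real $\tau$ with $|\tau|<3$ define $$P(x,\tau)=\sum_{k=1}^{\infty}\frac{1}{(k+1)!}\,\frac{\Gamma(x+k+1)}{\Gamma(x)}\left[\left(1-2^{-k-1}\right)\zeta(k+1)-1\right]\tau^{k},$$ $$N(x,\tau)=\left[\log\left(2\sqrt{\pi}\right)-1-\frac{\gamma}{2}\right]x+\sum_{k=1}^{\infty}\frac{(-1)^{k}}{(k+1)!}\,\frac{\Gamma(x+k+1)}{\Gamma(x)}\,\eta_k\,\tau^{k},$$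 where $\Gamma(x+k+1)/\Gamma(x)$ stands for $x(x+1)\cdots(x+k)$ when $x$ is a non-positive integer. Then for all real $x$ and all real $\tau$ with $|\tau|<3$ both series and the paired sum over the zeros converge absolutely, and for $\tau\neq0$ $$F(x,\tau)=P(x,\tau)+N(x,\tau);$$ for $\tau\to0$ the function $F(x,\tau)$ tends to $P(x,0)+N(x,0)$. Moreover, if $x>0$ and $0<\tau<3$, then $P(x,\tau)>0$ and $N(x,\tau)<0$. -/

import Mathlib

open Filter Topology

noncomputable section

namespace LiType

/-- The nontrivial zeros of the Riemann zeta function: its zeros in the open critical strip. -/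
def NontrivialZeros : Set ℂ :=
  {ρ : ℂ | riemannZeta ρ = 0 ∧ 0 < ρ.re ∧ ρ.re < 1}

/-- The contribution `1 - (ρ / (ρ - τ)) ^ x` of one zero (principal branch of the power). -/
def zeroTerm (x τ : ℝ) (ρ : ℂ) : ℂ :=
  1 - (ρ / (ρ - (τ : ℂ))) ^ (x : ℂ)

/-- The contribution of the zero `ρ`, paired with that of `1 - ρ`, counted with multiplicity.
The factor `1 / 2` is there because every pair `{ρ, 1 - ρ}` is met twice when `ρ` runs over all
nontrivial zeros. -/
def pairedTerm (x τ : ℝ) (ρ : NontrivialZeros) : ℂ :=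
  (analyticOrderNatAt riemannZeta (ρ : ℂ) : ℂ) *
    ((zeroTerm x τ (ρ : ℂ) + zeroTerm x τ (1 - (ρ : ℂ))) / 2)

/-- `F(x, τ) = (1 / τ) ∑_ρ [1 - (ρ / (ρ - τ)) ^ x]`, the sum running over the nontrivial zeros
of zeta with multiplicity, the terms of `ρ` and `1 - ρ` being paired. -/
def F (x τ : ℝ) : ℂ :=
  (1 / (τ : ℂ)) * ∑' ρ : NontrivialZeros, pairedTerm x τ ρ

/-- The quotient `Γ(x + k + 1) / Γ(x)`, written as `x (x + 1) ⋯ (x + k)` so that it keeps its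
meaning (by continuity) at the poles `x = 0, -1, -2, …` of the Gamma function. -/
def gammaQuot (x : ℝ) (k : ℕ) : ℝ :=
  ∏ j ∈ Finset.range (k + 1), (x + j)

theorem gammaQuot_eq (x : ℝ) (hx : ∀ m : ℕ, x ≠ -m) (k : ℕ) :
    gammaQuot x k = Real.Gamma (x + k + 1) / Real.Gamma x := by
  have h0 : Real.Gamma x ≠ 0 := Real.Gamma_ne_zero hx
  rw [eq_div_iff h0]
  induction k with
  | zero =>
    have : x ≠ 0 := by simpa using hx 0
    simp [gammaQuot, Real.Gamma_add_one this]
  | succ k ih =>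
    have h1 : x + ((k + 1 : ℕ) : ℝ) ≠ 0 := fun h => hx (k + 1) (by linarith)
    rw [Real.Gamma_add_one h1]
    have h2 : gammaQuot x (k + 1) = gammaQuot x k * (x + ((k + 1 : ℕ) : ℝ)) := by
      unfold gammaQuot
      rw [Finset.prod_range_succ]
    rw [h2, mul_right_comm, ih]
    push_cast
    rw [← add_assoc]
    ring

/-- The coefficients `η_k` in the expansion
`ζ'(s) / ζ(s) = - 1 / (s - 1) - ∑_k η_k (s - 1) ^ k` around `s = 1`, as Taylor coefficients of
`-(ζ'(s) / ζ(s) + 1 / (s - 1))`, which is minus the logarithmic derivative of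
`riemannZeta₁ s = (s - 1) ζ(s)`. That this expansion holds is `hasSum_eta`. -/
def eta (k : ℕ) : ℝ :=
  -(iteratedDeriv k (logDeriv riemannZeta₁) 1).re / (k.factorial : ℝ)

open ComplexConjugate in
theorem iteratedDeriv_logDeriv_conj (k : ℕ) :
    conj ∘ iteratedDeriv k (logDeriv riemannZeta₁) ∘ conj
      = iteratedDeriv k (logDeriv riemannZeta₁) := by
  have h₁ : conj ∘ riemannZeta₁ ∘ conj = riemannZeta₁ := by
    ext s
    by_cases hs : s = 1
    · subst hs; simp
    · have hs' : conj s ≠ 1 := (map_ne_one_iff _ (starRingEnd ℂ).injective).mpr hs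
      simp [riemannZeta₁, riemannZeta₀, hs, hs']
  induction k with
  | zero =>
    ext s
    have h₂ : conj (deriv riemannZeta₁ (conj s)) = deriv riemannZeta₁ s := by
      conv_rhs => rw [← h₁]
      simp [deriv_conj_conj]
    have h₃ : conj (riemannZeta₁ (conj s)) = riemannZeta₁ s := congrFun h₁ s
    simp [logDeriv_apply, h₂, h₃]
  | succ k ih =>
    ext s
    rw [iteratedDeriv_succ]
    conv_rhs => rw [← ih]
    simp [deriv_conj_conj]

theorem ofReal_eta (k : ℕ) :
    (eta k : ℂ) = -(iteratedDeriv k (logDeriv riemannZeta₁) 1) / (k.factorial : ℂ) := by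
  have h := congrFun (iteratedDeriv_logDeriv_conj k) 1
  simp only [Function.comp_apply, map_one] at h
  have h' := Complex.conj_eq_iff_re.mp h
  unfold eta
  push_cast
  rw [h']

theorem hasSum_eta : ∀ᶠ s in 𝓝[≠] (1 : ℂ),
    HasSum (fun k : ℕ => (eta k : ℂ) * (s - 1) ^ k)
      (-(deriv riemannZeta s / riemannZeta s) - 1 / (s - 1)) := by
  have han : AnalyticAt ℂ (logDeriv riemannZeta₁) 1 := by
    have h1 : AnalyticAt ℂ riemannZeta₁ 1 := differentiable_riemannZeta₁.analyticAt 1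
    exact h1.deriv.div h1 (by simp)
  have hps := han.hasFPowerSeriesAt
  have hs := (hasFPowerSeriesAt_iff.mp hps)
  have ht : Tendsto (fun s : ℂ => s - 1) (𝓝[≠] (1 : ℂ)) (𝓝 0) := by
    have : Tendsto (fun s : ℂ => s - 1) (𝓝 (1 : ℂ)) (𝓝 (1 - 1)) := by
      exact (continuous_id.sub continuous_const).tendsto 1
    rw [sub_self] at this
    exact this.mono_left nhdsWithin_le_nhds
  filter_upwards [ht.eventually hs, log_deriv_riemannZeta_eq_neg_inv_sub_add] with s h1 h2
  rw [h2]
  have h3 := h1.neg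
  have e1 : (fun k : ℕ => (eta k : ℂ) * (s - 1) ^ k) = fun k : ℕ => -((s - 1) ^ k •
      (FormalMultilinearSeries.ofScalars ℂ
        fun n => iteratedDeriv n (logDeriv riemannZeta₁) 1 / (n.factorial : ℂ)).coeff k) := by
    funext k
    rw [ofReal_eta, FormalMultilinearSeries.coeff_ofScalars, smul_eq_mul]
    ring
  have e2 : -(-(s - 1)⁻¹ + deriv riemannZeta₁ s / riemannZeta₁ s) - 1 / (s - 1)
      = -logDeriv riemannZeta₁ (1 + (s - 1)) := by
    rw [add_sub_cancel, logDeriv_apply]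
    ring
  rw [e1, e2]
  exact h3

/-- The general term, of index `k`, of the series defining `P`. -/
def termP (x τ : ℝ) (k : ℕ) : ℝ :=
  1 / ((k + 1).factorial : ℝ) * gammaQuot x k *
    ((1 - (2 : ℝ) ^ (-(k : ℤ) - 1)) * (riemannZeta ((k : ℂ) + 1)).re - 1) * τ ^ k

/-- `P(x, τ)`, the sum of the terms of index `k ≥ 1`. -/
def P (x τ : ℝ) : ℝ :=
  ∑' k : ℕ, termP x τ (k + 1)

/-- The general term, of index `k`, of the series in the definition of `N`. -/
def termN (x τ : ℝ) (k : ℕ) : ℝ :=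
  (-1) ^ k / ((k + 1).factorial : ℝ) * gammaQuot x k * eta k * τ ^ k

/-- `N(x, τ)`: a linear term in `x` plus the sum of the terms of index `k ≥ 1`. -/
def N (x τ : ℝ) : ℝ :=
  (Real.log (2 * Real.sqrt Real.pi) - 1 - Real.eulerMascheroniConstant / 2) * x +
    ∑' k : ℕ, termN x τ (k + 1)

end LiType

end

noncomputable section

namespace LiType

open Metric

/-! ### Dividing an entire function by finitely many of its zeros -/

/-! Expand each term by the binomial series in `τ / ρ`. Summed over the zeros, the coefficient of `τ
^ (k + 1)` becomes a multiple of the power sum of `1 / ρ ^ (k + 1)`, and these power sums are Taylor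
coefficients at `1` of the logarithmic derivative of `xi`, twice the Riemann xi function. Near `1`
this logarithmic derivative is that of a Gamma factor plus that of `(s - 1) ζ(s)`. The first gives
the sums over odd `n ≥ 3` that form `P`, the second gives the `eta k` of `N`, and both contribute to
the constant term `liConst`, which is minus the coefficient of the linear term of `N`.

The power sums are obtained without a Hadamard product (`SlowGrowth.tendsto_sum_inv_pow`,
`SlowGrowth.tendsto_sum_inv_sub_inv`). Remove from `xi` its zeros in a disc of radius `R` and take a
logarithm `h` of the quotient. Borel–Carathéodory bounds `h` by the logarithmic growth of `xi`,
which is `o(R ^ 2)`, so by Cauchy's estimates the derivatives of `h` of order at least two vanish in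
the limit.

The range `|τ| < 3` comes from the linear case. The sum of `1 / ρ + 1 / (1 - ρ)` has positive real
parts and equals `2 * liConst < 1 / 10`; since each zero contributes at least `1 / (1 + (Im ρ) ^
2)`, every zero satisfies `|Im ρ| > 3` (`nine_lt_im_sq`). The same bound makes the double series
over zeros and powers absolutely convergent, so the order of summation may be exchanged
(`hasSum_pairedTerm`). It also decides the sign of `N`: the power sum of order `k + 1` is smaller
than `3 ^ (-(k + 1))`, the first term of the odd sum, so the odd sum forces `(-1) ^ k * eta k < 0`.
-/

theorem exists_differentiable_eq_pow_mul {f : ℂ → ℂ} (hf : Differentiable ℂ f) {a : ℂ}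
    (ha : analyticOrderAt f a ≠ ⊤) :
    ∃ g : ℂ → ℂ, Differentiable ℂ g ∧ g a ≠ 0 ∧
      ∀ z, f z = (z - a) ^ analyticOrderNatAt f a * g z := by
  obtain ⟨g₀, hg₀, hg₀a, hfg⟩ := (hf.analyticAt a).analyticOrderAt_ne_top.mp ha
  set n := analyticOrderNatAt f a
  have hupd : ∀ z, z ≠ a → Function.update (fun z => f z / (z - a) ^ n) a (g₀ a) z
      = f z / (z - a) ^ n := fun z hz => Function.update_of_ne hz _ _
  refine ⟨Function.update (fun z => f z / (z - a) ^ n) a (g₀ a), fun z => ?_, by simpa, fun z => ?_⟩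
  · by_cases hz : z = a
    · subst hz
      refine hg₀.differentiableAt.congr_of_eventuallyEq ?_
      filter_upwards [hfg] with w hw
      by_cases hwz : w = z
      · simp [hwz]
      · rw [hupd w hwz, hw, smul_eq_mul, mul_div_cancel_left₀]
        exact pow_ne_zero _ (sub_ne_zero.mpr hwz)
    · have h : DifferentiableAt ℂ (fun z => f z / (z - a) ^ n) z :=
        (hf z).div (by fun_prop) (pow_ne_zero _ (sub_ne_zero.mpr hz))
      refine h.congr_of_eventuallyEq ?_
      filter_upwards [isOpen_ne.mem_nhds hz] with w hw using hupd w hw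
  · by_cases hz : z = a
    · subst hz
      simpa using hfg.self_of_nhds
    · rw [hupd z hz, mul_div_cancel₀]
      exact pow_ne_zero _ (sub_ne_zero.mpr hz)

theorem exists_differentiable_eq_prod_mul {f : ℂ → ℂ} (hf : Differentiable ℂ f)
    (hord : ∀ a, analyticOrderAt f a ≠ ⊤) (S : Finset ℂ) :
    ∃ g : ℂ → ℂ, Differentiable ℂ g ∧ (∀ a ∈ S, g a ≠ 0) ∧
      ∀ z, f z = (∏ a ∈ S, (z - a) ^ analyticOrderNatAt f a) * g z := by
  classical
  induction S using Finset.induction_on with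
  | empty => exact ⟨f, hf, by simp, by simp⟩
  | insert b S hb ih =>
    obtain ⟨g, hg, hgS, hfg⟩ := ih
    set p : ℂ → ℂ := fun z => ∏ a ∈ S, (z - a) ^ analyticOrderNatAt f a
    have hp : Differentiable ℂ p := by fun_prop
    have hpb : p b ≠ 0 := Finset.prod_ne_zero_iff.mpr fun a ha =>
      pow_ne_zero _ (sub_ne_zero.mpr fun h => hb (h ▸ ha))
    -- The factors already split off do not vanish at `b`, so the multiplicity there is still that
    -- of `f`.
    have hord' : analyticOrderAt f b = analyticOrderAt g b := by
      have : f = p * g := funext hfg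
      rw [this, analyticOrderAt_mul (hp.analyticAt b) (hg.analyticAt b),
        (hp.analyticAt b).analyticOrderAt_eq_zero.mpr hpb, zero_add]
    have hnat : analyticOrderNatAt f b = analyticOrderNatAt g b := by
      simp only [analyticOrderNatAt, hord']
    obtain ⟨h, hh, hhb, hgh⟩ := exists_differentiable_eq_pow_mul hg (hord' ▸ hord b)
    refine ⟨h, hh, fun a ha => ?_, fun z => ?_⟩
    · rcases Finset.mem_insert.mp ha with rfl | ha
      · exact hhb
      · intro h0
        exact hgS a ha (by rw [hgh, h0, mul_zero])
    · rw [Finset.prod_insert hb, hfg z, hgh z, hnat]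
      ring

/-! ### Logarithm of an entire function with the zeros of a disc removed -/

/-- A primitive of `logDeriv g` exists on a disc; the quotient of its exponential by `g` has
derivative zero. -/
theorem exists_log_of_ne_zero {g : ℂ → ℂ} (hg : Differentiable ℂ g) {c : ℂ} {R : ℝ} (hR : 0 < R)
    (hg0 : ∀ z ∈ ball c R, g z ≠ 0) (hgc : g c = 1) :
    ∃ h : ℂ → ℂ, h c = 0 ∧ (∀ z ∈ ball c R, HasDerivAt h (logDeriv g z) z) ∧
      ∀ z ∈ ball c R, Complex.exp (h z) = g z := by
  have hd : DifferentiableOn ℂ (logDeriv g) (ball c R) := fun z hz =>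
    (((hg.contDiff (n := 2)).differentiable_deriv_two z).div (hg z)
      (hg0 z hz)).differentiableWithinAt
  obtain ⟨h, hh⟩ := hd.isExactOn_ball
  have hcR : c ∈ ball c R := mem_ball_self hR
  refine ⟨fun z => h z - h c, by simp, fun z hz => (hh z hz).sub_const _, ?_⟩
  set q : ℂ → ℂ := fun z => Complex.exp (h z - h c) / g z
  have hq : ∀ z ∈ ball c R, HasDerivAt q 0 z := by
    intro z hz
    refine ((((hh z hz).sub_const (h c)).cexp).fun_div (hg z).hasDerivAt (hg0 z hz)).congr_deriv ?_
    have := hg0 z hz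
    rw [logDeriv_apply]
    field_simp
    ring
  have hconst : ∀ z ∈ ball c R, q z = q c := fun z hz =>
    isOpen_ball.is_const_of_deriv_eq_zero (convex_ball c R).isPreconnected
      (fun w hw => (hq w hw).differentiableAt.differentiableWithinAt)
      (fun w hw => (hq w hw).deriv) hz hcR
  intro z hz
  have h2 := hconst z hz
  have : q c = 1 := by simp [q, hgc]
  rw [this, div_eq_one_iff_eq (hg0 z hz)] at h2
  exact h2

/-- For an entire function `f` with `f c = 1`, let `S` be the set of its zeros in a disc. A
logarithm of `f` divided by the polynomial with these zeros is bounded on the disc of half the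
radius in terms of a bound of `log ‖f‖` on the disc of twice the radius. -/
theorem exists_log_div_zeros {f : ℂ → ℂ} (hf : Differentiable ℂ f) {c : ℂ} (hfc : f c = 1)
    {R B : ℝ} (hR : 0 < R) (hB : 0 < B)
    (hfB : ∀ z ∈ closedBall c (2 * R), ‖f z‖ ≤ Real.exp B) {S : Finset ℂ}
    (hS : ∀ a, a ∈ S ↔ f a = 0 ∧ a ∈ closedBall c R) :
    ∃ h : ℂ → ℂ, DifferentiableOn ℂ h (ball c R) ∧
      (∀ z ∈ closedBall c (R / 2), ‖h z‖ ≤ 2 * B) ∧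
      ∀ z ∈ ball c R, f z ≠ 0 →
        deriv h z = logDeriv f z - ∑ a ∈ S, (analyticOrderNatAt f a : ℂ) / (z - a) := by
  have hord : ∀ a, analyticOrderAt f a ≠ ⊤ := fun a =>
    AnalyticOnNhd.analyticOrderAt_ne_top_of_isPreconnected (U := Set.univ) (x := c)
      (fun z _ => hf.analyticAt z) isPreconnected_univ trivial trivial
      (by rw [(hf.analyticAt c).analyticOrderAt_eq_zero.mpr (by simp [hfc])]; simp)
  obtain ⟨g, hg, hgS, hfg⟩ := exists_differentiable_eq_prod_mul hf hord S
  set m := analyticOrderNatAt f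
  have hcS : ∀ a ∈ S, c - a ≠ 0 := by
    intro a ha h
    have := ((hS a).mp ha).1
    rw [← sub_eq_zero.mp h, hfc] at this
    exact one_ne_zero this
  set K : ℂ := ∏ a ∈ S, (c - a) ^ m a
  have hK : K ≠ 0 := Finset.prod_ne_zero_iff.mpr fun a ha => pow_ne_zero _ (hcS a ha)
  set G : ℂ → ℂ := fun z => K * g z
  have hG : Differentiable ℂ G := by fun_prop
  have hGc : G c = 1 := by rw [← hfc, hfg c]
  have hG0 : ∀ z ∈ ball c R, G z ≠ 0 := by
    intro z hz h0
    have hgz : g z = 0 := (mul_eq_zero.mp h0).resolve_left hK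
    have : z ∈ S := (hS z).mpr ⟨by rw [hfg, hgz, mul_zero], ball_subset_closedBall hz⟩
    exact hgS z this hgz
  -- On the circle of radius `2 * R` each removed zero `a` satisfies `‖w - a‖ ≥ R ≥ ‖c - a‖`, so the
  -- normalised division does not increase `‖f‖`; the maximum principle carries the bound inside.
  have hGB : ∀ z ∈ closedBall c (2 * R), ‖G z‖ ≤ Real.exp B := by
    intro z hz
    rw [← closure_ball c (by positivity)] at hz
    refine Complex.norm_le_of_forall_mem_frontier_norm_le isBounded_ball
      hG.diffContOnCl (fun w hw => ?_) hz
    rw [frontier_ball c (by positivity)] at hw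
    refine le_trans ?_ (hfB w (sphere_subset_closedBall hw))
    rw [hfg w, norm_mul, norm_mul]
    refine mul_le_mul_of_nonneg_right ?_ (norm_nonneg _)
    simp only [K, norm_prod, norm_pow]
    refine Finset.prod_le_prod (fun a _ => by positivity) fun a ha => ?_
    gcongr
    have h1 : ‖a - c‖ ≤ R := by simpa [dist_eq_norm] using ((hS a).mp ha).2
    have h2 : ‖w - c‖ = 2 * R := by simpa [dist_eq_norm] using hw
    rw [norm_sub_rev c a]
    have h3 : ‖w - c‖ ≤ ‖w - a‖ + ‖a - c‖ := norm_sub_le_norm_sub_add_norm_sub w a c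
    linarith
  obtain ⟨h, hc, hh, hexp⟩ := exists_log_of_ne_zero hG hR hG0 hGc
  have hhd : DifferentiableOn ℂ h (ball c R) := fun z hz =>
    (hh z hz).differentiableAt.differentiableWithinAt
  refine ⟨h, hhd, fun z hz => ?_, fun z hz hfz => ?_⟩
  · have hsh : ∀ w ∈ ball (0 : ℂ) R, c + w ∈ ball c R := fun w hw => by simpa using hw
    have hzc : ‖z - c‖ ≤ R / 2 := by simpa [dist_eq_norm] using hz
    -- The bound is `2 * B * r / (R - r)` with `r = ‖z - c‖ ≤ R / 2`, hence at most `2 * B`.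
    have hbc := Complex.borelCaratheodory_zero (f := fun w => h (c + w)) (R := R) (z := z - c) hB
      (hhd.comp (by fun_prop) hsh) (fun w hw => ?_) hR
      (by simpa using lt_of_le_of_lt hzc (by linarith)) (by simpa using hc)
    · simp only [add_sub_cancel] at hbc
      refine hbc.trans ?_
      rw [div_le_iff₀ (by linarith)]
      exact mul_le_mul_of_nonneg_left (by linarith) (by linarith)
    · have h1 := hGB _ (ball_subset_ball (by linarith : R ≤ 2 * R) |>.trans
        ball_subset_closedBall <| hsh w hw)
      rw [← hexp _ (hsh w hw), Complex.norm_exp] at h1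
      exact Real.exp_le_exp.mp h1
  · rw [(hh z hz).deriv]
    have hfz' := hfz
    rw [hfg z] at hfz'
    obtain ⟨hp, hgz⟩ := mul_ne_zero_iff.mp hfz'
    have hza : ∀ a ∈ S, (z - a) ^ m a ≠ 0 := Finset.prod_ne_zero_iff.mp hp
    have e1 : logDeriv f z = ∑ a ∈ S, (m a : ℂ) / (z - a) + logDeriv g z := by
      have : f = fun z => (∏ a ∈ S, (z - a) ^ m a) * g z := funext hfg
      rw [this, logDeriv_mul z hp hgz (by fun_prop) (hg z), logDeriv_prod hza (fun a _ => by fun_prop)]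
      congr 1
      refine Finset.sum_congr rfl fun a _ => ?_
      rw [logDeriv_fun_pow (by fun_prop), logDeriv_apply]
      simp [div_eq_mul_inv]
    rw [e1, add_sub_cancel_left]
    exact logDeriv_const_mul z K hK

/-! ### Power sums over the zeros of an entire function -/

theorem iteratedDeriv_inv_sub {a c : ℂ} (k : ℕ) :
    iteratedDeriv k (fun z : ℂ => (z - a)⁻¹) c = (-1) ^ k * k.factorial / (c - a) ^ (k + 1) := by
  have := congrFun (iter_deriv_inv_linear_sub k (1 : ℂ) a) c
  simp only [one_mul, one_pow, mul_one] at this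
  rw [iteratedDeriv_eq_iterate, this, div_eq_mul_inv]
  congr 1
  rw [show (-1 - (k : ℤ)) = -((k + 1 : ℕ) : ℤ) by push_cast; ring, zpow_neg, zpow_natCast]

/-- An entire function `f` with `f c = 1` of growth less than `exp (R ^ 2)`, together with the
finite sets `S n` of its zeros in the discs of radius `n + 1` around `c`. -/
structure SlowGrowth (f : ℂ → ℂ) (c : ℂ) (S : ℕ → Finset ℂ) (B : ℕ → ℝ) : Prop where
  differentiable : Differentiable ℂ f
  apply_center : f c = 1
  pos : ∀ n, 0 < B n
  bound : ∀ n : ℕ, ∀ z ∈ closedBall c (2 * (n + 1 : ℝ)), ‖f z‖ ≤ Real.exp (B n)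
  tendsto : Tendsto (fun n : ℕ => B n / (n + 1 : ℝ) ^ 2) atTop (𝓝 0)
  mem_iff : ∀ n a, a ∈ S n ↔ f a = 0 ∧ a ∈ closedBall c (n + 1 : ℝ)

variable {f : ℂ → ℂ} {c : ℂ} {S : ℕ → Finset ℂ} {B : ℕ → ℝ}

theorem SlowGrowth.exists_log (hf : SlowGrowth f c S B) (n : ℕ) :
    ∃ h : ℂ → ℂ, DifferentiableOn ℂ h (ball c (n + 1 : ℝ)) ∧
      (∀ z ∈ closedBall c ((n + 1 : ℝ) / 2), ‖h z‖ ≤ 2 * B n) ∧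
      ∀ z ∈ ball c (n + 1 : ℝ), f z ≠ 0 →
        deriv h z = logDeriv f z - ∑ a ∈ S n, (analyticOrderNatAt f a : ℂ) / (z - a) :=
  exists_log_div_zeros hf.differentiable hf.apply_center (by positivity) (hf.pos n) (hf.bound n)
    (hf.mem_iff n)

theorem norm_iteratedDeriv_le_of_norm_le {h : ℂ → ℂ} {R M r : ℝ} (hr : 0 < r)
    (hh : DifferentiableOn ℂ h (ball c R)) {z : ℂ} (hz : ‖z - c‖ + r ≤ R / 2) (hR : 0 < R)
    (hM : ∀ z ∈ closedBall c (R / 2), ‖h z‖ ≤ M) (k : ℕ) :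
    ‖iteratedDeriv k h z‖ ≤ k.factorial * M / r ^ k := by
  have hsub : closedBall z r ⊆ closedBall c (R / 2) :=
    closedBall_subset_closedBall' (by rw [dist_eq_norm]; linarith)
  refine Complex.norm_iteratedDeriv_le_of_forall_mem_sphere_norm_le k hr ?_
    fun w hw => hM w (hsub (sphere_subset_closedBall hw))
  refine (hh.mono ?_).diffContOnCl
  exact closure_ball_subset_closedBall.trans
    (hsub.trans (closedBall_subset_ball (by linarith)))

/-- Up to a constant factor, the error is the derivative of order `k + 1` at `c` of the logarithm
with the zeros removed. Cauchy's estimate bounds it by a multiple of `B n / (n + 1) ^ (k + 1)`,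
which tends to zero because `k + 1 ≥ 2`. -/
theorem SlowGrowth.tendsto_sum_inv_pow (hf : SlowGrowth f c S B) {k : ℕ} (hk : 1 ≤ k) :
    Tendsto (fun n => ∑ a ∈ S n, (analyticOrderNatAt f a : ℂ) / (c - a) ^ (k + 1)) atTop
      (𝓝 ((-1) ^ k / k.factorial * iteratedDeriv k (logDeriv f) c)) := by
  have hfc0 : f c ≠ 0 := by simp [hf.apply_center]
  have hne : ∀ᶠ z in 𝓝 c, f z ≠ 0 := (hf.differentiable c).continuousAt.eventually_ne hfc0
  have hcS : ∀ n, ∀ a ∈ S n, c - a ≠ 0 := by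
    intro n a ha h
    exact hfc0 (sub_eq_zero.mp h ▸ ((hf.mem_iff n a).mp ha).1)
  have hLan : AnalyticAt ℂ (logDeriv f) c :=
    (hf.differentiable.analyticAt c).deriv.div (hf.differentiable.analyticAt c) hfc0
  have hkf : (k.factorial : ℂ) ≠ 0 := by exact_mod_cast k.factorial_ne_zero
  have key : ∀ n : ℕ,
      ‖(∑ a ∈ S n, (analyticOrderNatAt f a : ℂ) / (c - a) ^ (k + 1)) -
        (-1) ^ k / k.factorial * iteratedDeriv k (logDeriv f) c‖ ≤
      (k + 1).factorial * 2 ^ (k + 2) * (B n / (n + 1 : ℝ) ^ 2) := by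
    intro n
    obtain ⟨h, hhd, hhB, hhl⟩ := hf.exists_log n
    have hn : (0 : ℝ) < n + 1 := by positivity
    have e1 : iteratedDeriv (k + 1) h c = iteratedDeriv k (logDeriv f) c -
        (-1) ^ k * k.factorial * ∑ a ∈ S n, (analyticOrderNatAt f a : ℂ) / (c - a) ^ (k + 1) := by
      rw [iteratedDeriv_succ']
      have h1 : deriv h =ᶠ[𝓝 c] fun z => logDeriv f z -
          ∑ a ∈ S n, (analyticOrderNatAt f a : ℂ) * (z - a)⁻¹ := by
        filter_upwards [hne, ball_mem_nhds c hn] with z hz hzb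
        simpa [div_eq_mul_inv] using hhl z hzb hz
      have hcd : ∀ a ∈ S n, ContDiffAt ℂ k
          (fun z : ℂ => (analyticOrderNatAt f a : ℂ) * (z - a)⁻¹) c := fun a ha =>
        contDiffAt_const.mul ((contDiffAt_id.sub contDiffAt_const).inv (hcS n a ha))
      rw [h1.iteratedDeriv_eq k, iteratedDeriv_fun_sub hLan.contDiffAt (ContDiffAt.sum hcd),
        iteratedDeriv_fun_sum hcd, Finset.mul_sum]
      congr 1
      refine Finset.sum_congr rfl fun a ha => ?_
      rw [iteratedDeriv_const_mul_field, iteratedDeriv_inv_sub]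
      ring
    have e2 := norm_iteratedDeriv_le_of_norm_le (z := c) (r := (n + 1 : ℝ) / 2) (by positivity) hhd
      (by simp) hn hhB (k + 1)
    have e3 : (∑ a ∈ S n, (analyticOrderNatAt f a : ℂ) / (c - a) ^ (k + 1)) -
        (-1) ^ k / k.factorial * iteratedDeriv k (logDeriv f) c =
        -((-1) ^ k / k.factorial * iteratedDeriv (k + 1) h c) := by
      rw [e1]
      have h2 : ((-1 : ℂ) ^ k) * (-1) ^ k = 1 := by rw [← mul_pow]; simp
      field_simp
      linear_combination (-(∑ a ∈ S n, (analyticOrderNatAt f a : ℂ) / (c - a) ^ (k + 1)) *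
        k.factorial) * h2
    have hfac : (1 : ℝ) ≤ k.factorial := by exact_mod_cast k.factorial_pos
    have hBn := hf.pos n
    calc _ = ‖iteratedDeriv (k + 1) h c‖ / k.factorial := by
          rw [e3, norm_neg, norm_mul, norm_div, norm_pow]
          simp only [norm_neg, norm_one, one_pow, Complex.norm_natCast]
          ring
      _ ≤ ‖iteratedDeriv (k + 1) h c‖ := div_le_self (norm_nonneg _) hfac
      _ ≤ _ := e2
      _ = (k + 1).factorial * 2 ^ (k + 2) * (B n / (n + 1 : ℝ) ^ (k + 1)) := by
          rw [div_pow]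
          field_simp
          ring
      _ ≤ _ := by
          gcongr
          · linarith
          · lia
  rw [tendsto_iff_norm_sub_tendsto_zero]
  refine squeeze_zero (fun _ => norm_nonneg _) key ?_
  simpa using hf.tendsto.const_mul ((k + 1).factorial * 2 ^ (k + 2) : ℝ)

/-- The growth hypothesis does not make the first derivative of the remaining logarithm small, but
it does make its second derivative small; hence a difference of two values of the first derivative,
by the mean value inequality. -/
theorem SlowGrowth.tendsto_sum_inv_sub_inv (hf : SlowGrowth f c S B) {z : ℂ} (hz : f z ≠ 0) :
    Tendsto (fun n => ∑ a ∈ S n, (analyticOrderNatAt f a : ℂ) * (1 / (z - a) - 1 / (c - a))) atTop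
      (𝓝 (logDeriv f z - logDeriv f c)) := by
  have hfc0 : f c ≠ 0 := by simp [hf.apply_center]
  have key : ∀ n : ℕ, ‖z - c‖ ≤ (n + 1 : ℝ) / 4 →
      ‖(∑ a ∈ S n, (analyticOrderNatAt f a : ℂ) * (1 / (z - a) - 1 / (c - a))) -
        (logDeriv f z - logDeriv f c)‖ ≤ 64 * ‖z - c‖ * (B n / (n + 1 : ℝ) ^ 2) := by
    intro n hzn
    obtain ⟨h, hhd, hhB, hhl⟩ := hf.exists_log n
    have hn : (0 : ℝ) < n + 1 := by positivity
    have hsub : closedBall c ((n + 1 : ℝ) / 4) ⊆ ball c (n + 1 : ℝ) :=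
      closedBall_subset_ball (by linarith)
    have hzc : z ∈ closedBall c ((n + 1 : ℝ) / 4) := by simpa [dist_eq_norm] using hzn
    have hcc : c ∈ closedBall c ((n + 1 : ℝ) / 4) := mem_closedBall_self (by positivity)
    have e1 : (∑ a ∈ S n, (analyticOrderNatAt f a : ℂ) * (1 / (z - a) - 1 / (c - a))) -
        (logDeriv f z - logDeriv f c) = -(deriv h z - deriv h c) := by
      rw [hhl z (hsub hzc) hz, hhl c (hsub hcc) hfc0]
      simp only [mul_sub, Finset.sum_sub_distrib, mul_one_div]
      ring
    have e2 : ∀ w ∈ closedBall c ((n + 1 : ℝ) / 4), ‖deriv (deriv h) w‖ ≤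
        64 * (B n / (n + 1 : ℝ) ^ 2) := by
      intro w hw
      have hw' : ‖w - c‖ ≤ (n + 1 : ℝ) / 4 := by simpa [dist_eq_norm] using hw
      -- Cauchy's estimate gives `2! * (2 * B n) / ((n + 1) / 4) ^ 2`, whence the constant 64.
      have := norm_iteratedDeriv_le_of_norm_le (z := w) (r := (n + 1 : ℝ) / 4) (by positivity) hhd
        (by linarith) hn hhB 2
      rw [iteratedDeriv_succ, iteratedDeriv_one] at this
      refine this.trans (le_of_eq ?_)
      simp [Nat.factorial]
      field_simp
      ring
    have hdd : ∀ w ∈ closedBall c ((n + 1 : ℝ) / 4), DifferentiableAt ℂ (deriv h) w := fun w hw =>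
      (hhd.deriv isOpen_ball).differentiableAt (isOpen_ball.mem_nhds (hsub hw))
    have e3 := (convex_closedBall c ((n + 1 : ℝ) / 4)).norm_image_sub_le_of_norm_deriv_le
      hdd e2 hcc hzc
    rw [e1, norm_neg]
    linarith
  rw [tendsto_iff_norm_sub_tendsto_zero]
  refine squeeze_zero' (g := fun n : ℕ => 64 * ‖z - c‖ * (B n / (n + 1 : ℝ) ^ 2))
    (Eventually.of_forall fun _ => norm_nonneg _) ?_
    (by simpa using hf.tendsto.const_mul (64 * ‖z - c‖))
  filter_upwards [eventually_ge_atTop ⌈4 * ‖z - c‖⌉₊] with n hn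
  refine key n ?_
  have := Nat.ceil_le.mp hn
  linarith

/-! ### The entire function `xi` -/

/-- The function `s (s - 1) Λ(s)`, made entire; it is twice the Riemann xi function. -/
def xi (s : ℂ) : ℂ := s * (s - 1) * completedRiemannZeta₀ s + 1

theorem differentiable_xi : Differentiable ℂ xi := by
  have := differentiable_completedZeta₀
  unfold xi
  fun_prop

theorem xi_one_sub (s : ℂ) : xi (1 - s) = xi s := by
  unfold xi
  rw [completedRiemannZeta₀_one_sub]
  ring

theorem xi_one : xi 1 = 1 := by simp [xi]

theorem xi_zero : xi 0 = 1 := by simp [xi]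

/-- The shift by 2 in the Gamma factor absorbs the factor `s`, and `riemannZeta₁` absorbs `s - 1`,
so the formula also holds at `s = 1`, where the Taylor coefficients are needed. -/
theorem xi_eq {s : ℂ} (hs : 0 < s.re) :
    xi s = 2 * Real.pi * Complex.Gammaℝ (s + 2) * riemannZeta₁ s := by
  have h0 : s ≠ 0 := by rintro rfl; simp at hs
  have hpi : (Real.pi : ℂ) ≠ 0 := by exact_mod_cast Real.pi_ne_zero
  rw [Complex.Gammaℝ_add_two h0]
  by_cases h1 : s = 1
  · subst h1
    rw [xi_one, riemannZeta₁_one, Complex.Gammaℝ_one]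
    field_simp
  · have h1' : s - 1 ≠ 0 := sub_ne_zero.mpr h1
    have h1'' : 1 - s ≠ 0 := sub_ne_zero.mpr (Ne.symm h1)
    have hz : riemannZeta₁ s = (s - 1) * riemannZeta s := by
      rw [riemannZeta_eq_inv_sub_mul h1, mul_inv_cancel_left₀ h1']
    have hG : Complex.Gammaℝ s ≠ 0 := Complex.Gammaℝ_ne_zero_of_re_pos hs
    rw [hz, riemannZeta_def_of_ne_zero h0, completedRiemannZeta_eq, xi]
    field_simp
    ring

theorem nontrivialZeros_ne_one {ρ : ℂ} (h : ρ ∈ NontrivialZeros) : ρ ≠ 1 := by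
  rintro rfl
  simpa using h.2.2

theorem riemannZeta₁_eq {s : ℂ} (hs : s ≠ 1) : riemannZeta₁ s = (s - 1) * riemannZeta s := by
  rw [riemannZeta_eq_inv_sub_mul hs, mul_inv_cancel_left₀ (sub_ne_zero.mpr hs)]

theorem Gammaℝ_add_two_ne_zero {s : ℂ} (hs : 0 < s.re) : Complex.Gammaℝ (s + 2) ≠ 0 :=
  Complex.Gammaℝ_ne_zero_of_re_pos (by simp; linarith)

/-- For `Re s > 0` the other factors do not vanish away from `1`, and zeta has no zero with `Re s ≥
1`; the functional equation reflects the half-plane `Re s ≤ 0` into that region. -/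
theorem xi_eq_zero_iff {s : ℂ} : xi s = 0 ↔ s ∈ NontrivialZeros := by
  have hpi : (Real.pi : ℂ) ≠ 0 := by exact_mod_cast Real.pi_ne_zero
  have key : ∀ s : ℂ, 0 < s.re → xi s = 0 → riemannZeta s = 0 ∧ s.re < 1 := by
    intro s hs h
    have h1 : s ≠ 1 := by rintro rfl; simp [xi_one] at h
    rw [xi_eq hs, riemannZeta₁_eq h1] at h
    have hG := Gammaℝ_add_two_ne_zero hs
    have hz : riemannZeta s = 0 := by
      simpa [hG, hpi, sub_ne_zero.mpr h1] using h
    refine ⟨hz, ?_⟩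
    by_contra! hre
    exact riemannZeta_ne_zero_of_one_le_re hre hz
  constructor
  · intro h
    by_cases hs : 0 < s.re
    · exact ⟨(key s hs h).1, hs, (key s hs h).2⟩
    · push Not at hs
      have := (key (1 - s) (by simp; linarith) (by rw [xi_one_sub, h])).2
      simp at this
      linarith
  · rintro h
    rw [xi_eq h.2.1, riemannZeta₁_eq (nontrivialZeros_ne_one h), h.1]
    simp

theorem one_sub_mem_nontrivialZeros {ρ : ℂ} (h : ρ ∈ NontrivialZeros) :
    1 - ρ ∈ NontrivialZeros := by
  rw [← xi_eq_zero_iff, xi_one_sub, xi_eq_zero_iff]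
  exact h

theorem analyticAt_Gammaℝ_add_two {s : ℂ} (hs : 0 < s.re) :
    AnalyticAt ℂ (fun s : ℂ => Complex.Gammaℝ (s + 2)) s := by
  have hd : Differentiable ℂ fun s : ℂ => (Complex.Gammaℝ (s + 2))⁻¹ :=
    Complex.differentiable_Gammaℝ_inv.comp (differentiable_id.add_const 2)
  have := (hd.analyticAt s).inv (inv_ne_zero (Gammaℝ_add_two_ne_zero hs))
  refine this.congr (Eventually.of_forall fun w => ?_)
  simp

theorem eventually_re_pos {s : ℂ} (hs : 0 < s.re) : ∀ᶠ w in 𝓝 s, 0 < w.re :=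
  Complex.continuous_re.continuousAt.eventually (lt_mem_nhds hs)

theorem analyticOrderNatAt_xi {ρ : ℂ} (h : ρ ∈ NontrivialZeros) :
    analyticOrderNatAt xi ρ = analyticOrderNatAt riemannZeta ρ := by
  have hpi : (Real.pi : ℂ) ≠ 0 := by exact_mod_cast Real.pi_ne_zero
  have hρ1 := nontrivialZeros_ne_one h
  set u : ℂ → ℂ := fun s => 2 * Real.pi * Complex.Gammaℝ (s + 2) * (s - 1) with hu
  have huan : AnalyticAt ℂ u ρ :=
    (analyticAt_const.mul (analyticAt_Gammaℝ_add_two h.2.1)).mul (by fun_prop)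
  have hu0 : u ρ ≠ 0 := by
    simp [hu, hpi, Gammaℝ_add_two_ne_zero h.2.1, sub_ne_zero.mpr hρ1]
  have hz : AnalyticAt ℂ riemannZeta ρ :=
    DifferentiableOn.analyticAt (s := {1}ᶜ)
      (fun w hw => (differentiableAt_riemannZeta hw).differentiableWithinAt)
      (isOpen_compl_singleton.mem_nhds hρ1)
  have e : xi =ᶠ[𝓝 ρ] u * riemannZeta := by
    filter_upwards [eventually_re_pos h.2.1, isOpen_ne.mem_nhds hρ1] with w hw hw1
    rw [xi_eq hw, riemannZeta₁_eq hw1]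
    simp only [hu, Pi.mul_apply]
    ring
  rw [analyticOrderNatAt, analyticOrderNatAt, analyticOrderAt_congr e, analyticOrderAt_mul huan hz,
    huan.analyticOrderAt_eq_zero.mpr hu0, zero_add]

theorem analyticOrderNatAt_one_sub {ρ : ℂ} (h : ρ ∈ NontrivialZeros) :
    analyticOrderNatAt riemannZeta (1 - ρ) = analyticOrderNatAt riemannZeta ρ := by
  rw [← analyticOrderNatAt_xi h, ← analyticOrderNatAt_xi (one_sub_mem_nontrivialZeros h)]
  have hd : deriv (fun s : ℂ => 1 - s) ρ ≠ 0 := by simp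
  have := analyticOrderAt_comp_of_deriv_ne_zero (f := xi) (g := fun s : ℂ => 1 - s) (z₀ := ρ)
    (by fun_prop) hd
  have e : xi ∘ (fun s : ℂ => 1 - s) = xi := funext xi_one_sub
  rw [e] at this
  simp only [analyticOrderNatAt, this]

/-! ### Growth of `xi` -/

/-- On each side of `t = 1` one of the two extreme exponents dominates. The bound is independent of
`s`, hence uniform in the strip. -/
theorem norm_mellin_le {f : ℝ → ℂ} {s : ℂ} {a b : ℝ} (ha : MellinConvergent f a)
    (hb : MellinConvergent f b) (has : a ≤ s.re) (hsb : s.re ≤ b) :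
    ‖mellin f s‖ ≤ (∫ t in Set.Ioi (0 : ℝ), ‖(t : ℂ) ^ ((a : ℂ) - 1) • f t‖) +
      ∫ t in Set.Ioi (0 : ℝ), ‖(t : ℂ) ^ ((b : ℂ) - 1) • f t‖ := by
  rw [mellin, ← MeasureTheory.integral_add ha.norm hb.norm]
  refine MeasureTheory.norm_integral_le_of_norm_le (ha.norm.add hb.norm) ?_
  refine (MeasureTheory.ae_restrict_mem measurableSet_Ioi).mono fun t (ht : 0 < t) => ?_
  simp only [norm_smul, ← add_mul, Complex.norm_cpow_eq_rpow_re_of_pos ht, Complex.sub_re,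
    Complex.ofReal_re, Complex.one_re]
  refine mul_le_mul_of_nonneg_right ?_ (norm_nonneg _)
  rcases le_total t 1 with h1 | h1
  · have := Real.rpow_le_rpow_of_exponent_ge ht h1 (by linarith : a - 1 ≤ s.re - 1)
    have := Real.rpow_nonneg ht.le (b - 1)
    linarith
  · have := Real.rpow_le_rpow_of_exponent_le h1 (by linarith : s.re - 1 ≤ b - 1)
    have := Real.rpow_nonneg ht.le (a - 1)
    linarith

theorem exists_norm_completedRiemannZeta₀_le_strip :
    ∃ C : ℝ, ∀ s : ℂ, 0 ≤ s.re → s.re ≤ 4 → ‖completedRiemannZeta₀ s‖ ≤ C := by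
  set Q := HurwitzZeta.hurwitzEvenFEPair 0
  have hconv : ∀ s : ℂ, MellinConvergent Q.f_modif s := fun s =>
    (Q.isStrongFEPair_toStrongFEPair.hasMellin s).1
  have h := fun (s : ℂ) (h0 : 0 ≤ s.re) (h4 : s.re ≤ 4) =>
    norm_mellin_le (f := Q.f_modif) (s := s / 2) (a := 0) (b := 2) (hconv _) (hconv _)
      (by simp; linarith) (by simp; linarith)
  refine ⟨_, fun s h0 h4 => le_trans ?_ (h s h0 h4)⟩
  have e : completedRiemannZeta₀ s = mellin Q.f_modif (s / 2) / 2 := rfl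
  rw [e, norm_div]
  exact div_le_self (norm_nonneg _) (by simp)

theorem norm_Gamma_le {s : ℂ} (hs : 0 < s.re) : ‖Complex.Gamma s‖ ≤ Real.Gamma s.re := by
  rw [Complex.Gamma_eq_integral hs, Real.Gamma_eq_integral hs, Complex.GammaIntegral]
  refine MeasureTheory.norm_integral_le_of_norm_le (Real.GammaIntegral_convergent hs) ?_
  refine (MeasureTheory.ae_restrict_mem measurableSet_Ioi).mono fun t (ht : 0 < t) => ?_
  rw [norm_mul, Complex.norm_cpow_eq_rpow_re_of_pos ht]
  simp [Complex.norm_exp]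

theorem exists_norm_completedRiemannZeta_le :
    ∃ C : ℝ, 0 ≤ C ∧ ∀ s : ℂ, 4 ≤ s.re →
      ‖completedRiemannZeta s‖ ≤ C * Real.Gamma (s.re / 2) := by
  have hsum : Summable fun n : ℕ => 1 / (n : ℝ) ^ 2 :=
    Real.summable_one_div_nat_pow.mpr one_lt_two
  refine ⟨∑' n : ℕ, 1 / (n : ℝ) ^ 2, tsum_nonneg fun n => by positivity, fun s hs => ?_⟩
  have hterm : ∀ n : ℕ, ‖1 / (n : ℂ) ^ s‖ ≤ 1 / (n : ℝ) ^ 2 := by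
    intro n
    rcases n.eq_zero_or_pos with rfl | hn
    · have : s ≠ 0 := by rintro rfl; norm_num at hs
      simp [Complex.zero_cpow this]
    · rw [norm_div, norm_one, Complex.norm_natCast_cpow_of_pos hn, ← Real.rpow_natCast]
      have : (1 : ℝ) ≤ n := by exact_mod_cast hn
      gcongr
      push_cast
      linarith
  rw [completedZeta_eq_tsum_of_one_lt_re (by linarith), norm_mul, norm_mul,
    mul_comm (∑' n : ℕ, 1 / (n : ℝ) ^ 2)]
  have h1 : ‖(Real.pi : ℂ) ^ (-s / 2)‖ ≤ 1 := by
    rw [Complex.norm_cpow_eq_rpow_re_of_pos Real.pi_pos]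
    refine Real.rpow_le_one_of_one_le_of_nonpos (by linarith [Real.pi_gt_three]) ?_
    simp
    linarith
  have h2 : ‖Complex.Gamma (s / 2)‖ ≤ Real.Gamma (s.re / 2) := by
    have := norm_Gamma_le (s := s / 2) (by simp; linarith)
    simpa using this
  have h3 : ‖∑' n : ℕ, 1 / (n : ℂ) ^ s‖ ≤ ∑' n : ℕ, 1 / (n : ℝ) ^ 2 :=
    tsum_of_norm_bounded hsum.hasSum hterm
  have h4 : 0 ≤ Real.Gamma (s.re / 2) := (norm_nonneg _).trans h2
  calc _ ≤ 1 * Real.Gamma (s.re / 2) * ∑' n : ℕ, 1 / (n : ℝ) ^ 2 := by gcongr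
    _ = _ := by ring

/-- The functional equation reduces to `Re s ≥ 1 / 2`. Up to real part 4 the Mellin integral is
bounded; beyond, the Dirichlet series is bounded and Gamma supplies the growth. Two of the factors
`n + 4` account for `s (s - 1)`. -/
theorem exists_norm_xi_le :
    ∃ D : ℝ, 1 < D ∧ ∀ n : ℕ, ∀ z ∈ closedBall (1 : ℂ) (2 * (n + 1 : ℝ)),
      ‖xi z‖ ≤ D * (n + 4 : ℝ) ^ (n + 4) := by
  obtain ⟨C₁, hC₁⟩ := exists_norm_completedRiemannZeta₀_le_strip
  obtain ⟨C₂, hC₂0, hC₂⟩ := exists_norm_completedRiemannZeta_le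
  set C := max C₁ 0 + C₂ + 2
  have hm : 0 ≤ max C₁ 0 := le_max_right _ _
  have key : ∀ n : ℕ, ∀ s : ℂ, 1 / 2 ≤ s.re → ‖s‖ ≤ 2 * n + 3 →
      ‖xi s‖ ≤ (4 * C + 1) * (n + 4 : ℝ) ^ (n + 4) := by
    intro n s hre hn
    have hn4 : (1 : ℝ) ≤ n + 4 := by linarith [n.cast_nonneg (α := ℝ)]
    have hpow : (1 : ℝ) ≤ (n + 4 : ℝ) ^ (n + 2) := one_le_pow₀ hn4
    have h0 : ‖completedRiemannZeta₀ s‖ ≤ C * (n + 4 : ℝ) ^ (n + 2) := by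
      rcases le_total s.re 4 with h4 | h4
      · have := hC₁ s (by linarith) h4
        have h5 : C₁ ≤ C := by linarith [le_max_left C₁ 0]
        have h6 : 0 ≤ C := by positivity
        nlinarith
      · have e : completedRiemannZeta₀ s = completedRiemannZeta s + 1 / s + 1 / (1 - s) := by
          rw [completedRiemannZeta_eq]; ring
        have hsn : s.re ≤ ‖s‖ := Complex.re_le_norm s
        have hG : Real.Gamma (s.re / 2) ≤ (n + 4 : ℝ) ^ (n + 2) := by
          -- Gamma is increasing on `[2, ∞)`, which is why the strip ends at real part 4.
          have h1 : Real.Gamma (s.re / 2) ≤ Real.Gamma ((n + 2 : ℕ) + 1 : ℝ) := by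
            refine Real.Gamma_strictMonoOn_Ici.monotoneOn ?_ ?_ ?_
            · simp; linarith
            · simp only [Set.mem_Ici]; push_cast; linarith [n.cast_nonneg (α := ℝ)]
            · push_cast; linarith
          rw [Real.Gamma_nat_eq_factorial] at h1
          have h2 : ((n + 2).factorial : ℝ) ≤ ((n + 2 : ℕ) : ℝ) ^ (n + 2) := by
            exact_mod_cast Nat.factorial_le_pow (n + 2)
          have h3 : ((n + 2 : ℕ) : ℝ) ^ (n + 2) ≤ (n + 4 : ℝ) ^ (n + 2) := by
            gcongr
            push_cast
            linarith
          linarith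
        have hs1 : ‖1 / s‖ ≤ 1 := by
          rw [norm_div, norm_one]
          exact div_le_one_of_le₀ (by linarith) (norm_nonneg _)
        have hs2 : ‖1 / (1 - s)‖ ≤ 1 := by
          rw [norm_div, norm_one]
          refine div_le_one_of_le₀ ?_ (norm_nonneg _)
          have := Complex.abs_re_le_norm (1 - s)
          simp only [Complex.sub_re, Complex.one_re] at this
          linarith [neg_le_abs (1 - s.re)]
        have h7 := norm_add₃_le (a := completedRiemannZeta s) (b := 1 / s) (c := 1 / (1 - s))
        rw [e]
        have h8 := hC₂ s h4
        nlinarith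
    have hs1 : ‖s - 1‖ ≤ 2 * n + 4 := by
      have := norm_sub_le s 1
      rw [norm_one] at this
      linarith
    have hC : 0 ≤ C := by positivity
    calc ‖xi s‖ ≤ ‖s‖ * ‖s - 1‖ * ‖completedRiemannZeta₀ s‖ + 1 := by
          refine (norm_add_le _ _).trans (le_of_eq ?_)
          rw [norm_mul, norm_mul, norm_one]
      _ ≤ (2 * (n + 4)) * (2 * (n + 4)) * (C * (n + 4 : ℝ) ^ (n + 2)) + 1 := by
          gcongr <;> linarith
      _ = (4 * C) * (n + 4 : ℝ) ^ (n + 4) + 1 := by ring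
      _ ≤ _ := by
          have : (1 : ℝ) ≤ (n + 4 : ℝ) ^ (n + 4) := one_le_pow₀ hn4
          linarith
  refine ⟨4 * C + 1, by linarith, fun n z hz => ?_⟩
  have hz' : ‖z - 1‖ ≤ 2 * (n + 1 : ℝ) := by simpa [dist_eq_norm] using hz
  rcases le_total (1 / 2) z.re with h | h
  · refine key n z h ?_
    have : ‖z‖ ≤ ‖z - 1‖ + ‖(1 : ℂ)‖ := norm_le_norm_sub_add z 1
    rw [norm_one] at this
    linarith
  · rw [← xi_one_sub]
    refine key n (1 - z) (by simp; linarith) ?_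
    rw [norm_sub_rev]
    linarith

theorem tendsto_log_mul_pow_div_sq {D : ℝ} (hD : 1 < D) :
    Tendsto (fun n : ℕ => Real.log (D * (n + 4 : ℝ) ^ (n + 4)) / (n + 1 : ℝ) ^ 2) atTop (𝓝 0) := by
  have hlim : Tendsto (fun n : ℕ => (Real.log D + 16) * (1 / Real.sqrt (n + 1 : ℝ))) atTop
      (𝓝 0) := by
    have h1 : Tendsto (fun n : ℕ => (n + 1 : ℝ)) atTop atTop :=
      tendsto_atTop_add_const_right _ _ tendsto_natCast_atTop_atTop
    have h2 := ((Real.tendsto_sqrt_atTop.comp h1).inv_tendsto_atTop).const_mul (Real.log D + 16)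
    simpa using h2
  refine squeeze_zero (fun n => ?_) (fun n => ?_) hlim
  · have h1 : (1 : ℝ) ≤ (n + 4 : ℝ) ^ (n + 4) :=
      one_le_pow₀ (by linarith [n.cast_nonneg (α := ℝ)])
    have : 0 ≤ Real.log (D * (n + 4 : ℝ) ^ (n + 4)) := Real.log_nonneg (by nlinarith)
    positivity
  · have hn : (0 : ℝ) ≤ n := n.cast_nonneg
    set r := Real.sqrt (n + 1 : ℝ)
    have hr2 : r * r = n + 1 := Real.mul_self_sqrt (by linarith)
    have hr1 : 1 ≤ r := by rw [Real.one_le_sqrt]; linarith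
    -- From `n + 4 ≤ (2 * r) ^ 2` and `log y ≤ y - 1`; a logarithm of size `√n` already leaves a
    -- quotient of order `1 / r`.
    have hlog : Real.log (n + 4 : ℝ) ≤ 4 * r := by
      have h4 : (n + 4 : ℝ) ≤ (2 * r) ^ 2 := by nlinarith
      have h5 : Real.log (n + 4 : ℝ) ≤ Real.log ((2 * r) ^ 2) :=
        Real.log_le_log (by linarith) h4
      rw [Real.log_pow] at h5
      have h6 : Real.log (2 * r) ≤ 2 * r - 1 := Real.log_le_sub_one_of_pos (by linarith)
      push_cast at h5
      linarith
    have hDl : 0 ≤ Real.log D := Real.log_nonneg hD.le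
    rw [Real.log_mul (by linarith) (by positivity), Real.log_pow]
    push_cast
    rw [← hr2, mul_one_div, div_le_div_iff₀ (by positivity) (by positivity)]
    have h7 : (n + 4 : ℝ) ≤ 4 * (r * r) := by linarith
    have h8 : (n + 4 : ℝ) * Real.log (n + 4 : ℝ) ≤ 4 * (r * r) * (4 * r) := by
      have : 0 ≤ Real.log (n + 4 : ℝ) := Real.log_nonneg (by linarith)
      gcongr
    have h9 : Real.log D ≤ Real.log D * (r * r * r) :=
      le_mul_of_one_le_right hDl (one_le_mul_of_one_le_of_one_le
        (one_le_mul_of_one_le_of_one_le hr1 hr1) hr1)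
    calc _ ≤ (Real.log D * (r * r * r) + 4 * (r * r) * (4 * r)) * r := by gcongr
      _ = _ := by ring

theorem finite_nontrivialZeros_inter_closedBall (r : ℝ) :
    (NontrivialZeros ∩ closedBall (1 : ℂ) r).Finite :=
  ((isCompact_closedBall (1 : ℂ) r).inter_riemannZetaZeros_finite).subset
    fun _ h => ⟨h.2, h.1.1⟩

/-- The nontrivial zeros at distance at most `n + 1` from `1`. -/
def zerosNear (n : ℕ) : Finset ℂ :=
  (finite_nontrivialZeros_inter_closedBall (n + 1 : ℝ)).toFinset

theorem exists_slowGrowth_xi : ∃ B : ℕ → ℝ, SlowGrowth xi 1 zerosNear B := by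
  obtain ⟨D, hD, hxi⟩ := exists_norm_xi_le
  have h1 : ∀ n : ℕ, 1 < D * (n + 4 : ℝ) ^ (n + 4) := fun n => by
    have : (1 : ℝ) ≤ (n + 4 : ℝ) ^ (n + 4) :=
      one_le_pow₀ (by linarith [n.cast_nonneg (α := ℝ)])
    nlinarith
  refine ⟨fun n => Real.log (D * (n + 4 : ℝ) ^ (n + 4)), differentiable_xi, xi_one,
    fun n => Real.log_pos (h1 n), fun n z hz => ?_, tendsto_log_mul_pow_div_sq hD, fun n a => ?_⟩
  · rw [Real.exp_log (by linarith [h1 n])]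
    exact hxi n z hz
  · simp [zerosNear, xi_eq_zero_iff]

/-! ### Sums over the nontrivial zeros -/

/-- The multiplicity of a nontrivial zero. -/
def zeroMult (ρ : NontrivialZeros) : ℕ := analyticOrderNatAt riemannZeta (ρ : ℂ)

/-- The nontrivial zeros at distance at most `n + 1` from `1`, in the subtype. -/
def nontrivialZerosNear (n : ℕ) : Finset NontrivialZeros :=
  open scoped Classical in (zerosNear n).subtype (· ∈ NontrivialZeros)

theorem mem_nontrivialZerosNear {n : ℕ} {ρ : NontrivialZeros} :
    ρ ∈ nontrivialZerosNear n ↔ ‖(ρ : ℂ) - 1‖ ≤ n + 1 := by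
  simp [nontrivialZerosNear, zerosNear, dist_eq_norm]

theorem sum_zerosNear (n : ℕ) (g : ℂ → ℂ) :
    ∑ a ∈ zerosNear n, (analyticOrderNatAt xi a : ℂ) * g a =
      ∑ ρ ∈ nontrivialZerosNear n, (zeroMult ρ : ℂ) * g ρ := by
  classical
  have hmem : ∀ a ∈ zerosNear n, a ∈ NontrivialZeros := fun a ha => by
    simp only [zerosNear, Set.Finite.mem_toFinset] at ha
    exact ha.1
  rw [← Finset.sum_subtype_of_mem _ hmem]
  refine Finset.sum_congr ?_ fun ρ _ => ?_
  · ext ρ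
    simp [nontrivialZerosNear]
  · rw [zeroMult, analyticOrderNatAt_xi ρ.2]

theorem tendsto_nontrivialZerosNear : Tendsto nontrivialZerosNear atTop atTop := by
  refine tendsto_atTop_finset_of_monotone (fun m n hmn ρ hρ => ?_) fun ρ => ?_
  · rw [mem_nontrivialZerosNear] at hρ ⊢
    have : (m : ℝ) ≤ n := by exact_mod_cast hmn
    linarith
  · refine ⟨⌈‖(ρ : ℂ) - 1‖⌉₊, ?_⟩
    rw [mem_nontrivialZerosNear]
    linarith [Nat.le_ceil ‖(ρ : ℂ) - 1‖]

/-- Turns convergence along the discs `nontrivialZerosNear n` into unconditional summability, the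
source of all later bounds on the zeros. -/
theorem hasSum_of_tendsto_of_nonneg {ι : Type*} {T : ℕ → Finset ι} (hT : Tendsto T atTop atTop)
    {φ : ι → ℝ} (hφ : ∀ i, 0 ≤ φ i) {L : ℝ}
    (h : Tendsto (fun n => ∑ i ∈ T n, φ i) atTop (𝓝 L)) : HasSum φ L := by
  have hs : Summable φ := by
    obtain ⟨M, hM⟩ := h.bddAbove_range
    refine summable_of_sum_le (c := M) hφ fun u => ?_
    obtain ⟨n, hn⟩ := (hT.eventually_ge_atTop u).exists
    exact (Finset.sum_le_sum_of_subset_of_nonneg hn fun i _ _ => hφ i).trans (hM ⟨n, rfl⟩)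
  rw [← tendsto_nhds_unique (hs.hasSum.comp hT) h]
  exact hs.hasSum

/-- Half of the sum of `1 / ρ + 1 / (1 - ρ)` over the nontrivial zeros. -/
def liConst : ℝ :=
  1 + Real.eulerMascheroniConstant / 2 - Real.log (2 * Real.sqrt Real.pi)

theorem logDeriv_riemannZeta₁_one :
    logDeriv riemannZeta₁ 1 = Real.eulerMascheroniConstant := by
  simp [logDeriv_apply]

theorem logDeriv_Gammaℝ_add_two_one :
    logDeriv (fun s : ℂ => Complex.Gammaℝ (s + 2)) 1 =
      1 - (Real.eulerMascheroniConstant + Real.log (4 * Real.pi)) / 2 := by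
  have hpi : (Real.pi : ℂ) ≠ 0 := by exact_mod_cast Real.pi_ne_zero
  have e : (fun s : ℂ => Complex.Gammaℝ (s + 2)) =ᶠ[𝓝 1]
      fun s => Complex.Gammaℝ s * s / 2 / Real.pi := by
    filter_upwards [isOpen_ne.mem_nhds (one_ne_zero : (1 : ℂ) ≠ 0)] with s hs
      using Complex.Gammaℝ_add_two hs
  have h := ((Complex.hasDerivAt_Gammaℝ_one.mul (hasDerivAt_id (1 : ℂ))).div_const 2).div_const
    (Real.pi : ℂ)
  have hd : deriv (fun s : ℂ => Complex.Gammaℝ (s + 2)) 1 =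
      (-(Real.eulerMascheroniConstant + Complex.log (4 * Real.pi)) / 2 * 1 + 1 * 1) / 2 /
        Real.pi := by
    rw [e.deriv_eq]
    have := h.deriv
    simp only [id, Complex.Gammaℝ_one] at this
    exact this
  rw [logDeriv_apply, hd, Complex.Gammaℝ_add_two one_ne_zero, Complex.Gammaℝ_one, Complex.ofReal_log (by positivity)]
  push_cast
  field_simp
  ring

theorem logDeriv_xi_eventuallyEq :
    logDeriv xi =ᶠ[𝓝 1] fun s => logDeriv (fun s : ℂ => Complex.Gammaℝ (s + 2)) s +
      logDeriv riemannZeta₁ s := by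
  have hpi : (Real.pi : ℂ) ≠ 0 := by exact_mod_cast Real.pi_ne_zero
  filter_upwards [eventually_re_pos (s := 1) (by simp), riemannZeta₁_ne_zero_of_near_one]
    with s hs hz
  have e : xi =ᶠ[𝓝 s] fun s => (2 * Real.pi * Complex.Gammaℝ (s + 2)) * riemannZeta₁ s :=
    (eventually_re_pos hs).mono fun w hw => xi_eq hw
  have e' : logDeriv xi s = logDeriv
      (fun s => (2 * Real.pi * Complex.Gammaℝ (s + 2)) * riemannZeta₁ s) s := by
    rw [logDeriv_apply, logDeriv_apply, e.deriv_eq, e.self_of_nhds]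
  have hG := (analyticAt_Gammaℝ_add_two hs).differentiableAt
  rw [e', logDeriv_mul (f := fun s => 2 * Real.pi * Complex.Gammaℝ (s + 2)) s
    (by simp [hpi, Gammaℝ_add_two_ne_zero hs]) hz (hG.const_mul _)
    (differentiable_riemannZeta₁ s), logDeriv_const_mul s _ (by simp [hpi])]

theorem logDeriv_xi_one : logDeriv xi 1 = liConst := by
  have hlog : Real.log (2 * Real.sqrt Real.pi) = Real.log (4 * Real.pi) / 2 := by
    rw [← Real.log_sqrt (by positivity), Real.sqrt_mul (by norm_num)]
    norm_num
  have h := logDeriv_xi_eventuallyEq.self_of_nhds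
  simp only at h
  rw [h, logDeriv_riemannZeta₁_one, logDeriv_Gammaℝ_add_two_one, liConst, hlog]
  push_cast
  ring

theorem logDeriv_xi_zero : logDeriv xi 0 = -liConst := by
  have h : deriv xi 0 = -deriv xi 1 := by
    have e : xi = fun s => xi (1 - s) := funext fun s => (xi_one_sub s).symm
    conv_lhs => rw [e, deriv_comp_const_sub]
    simp
  have h1 := logDeriv_xi_one
  rw [logDeriv_apply, xi_one, div_one] at h1
  rw [logDeriv_apply, xi_zero, h, h1, div_one]

variable (ρ : NontrivialZeros)

theorem zero_ne_zero : (ρ : ℂ) ≠ 0 := by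
  intro h
  have := ρ.2.2.1
  simp [h] at this

theorem one_sub_zero_ne_zero : 1 - (ρ : ℂ) ≠ 0 :=
  sub_ne_zero.mpr (nontrivialZeros_ne_one ρ.2).symm

theorem one_le_zeroMult : 1 ≤ zeroMult ρ := by
  rw [zeroMult, ← analyticOrderNatAt_xi ρ.2, Nat.one_le_iff_ne_zero]
  have hord : analyticOrderAt xi ρ ≠ ⊤ :=
    AnalyticOnNhd.analyticOrderAt_ne_top_of_isPreconnected (U := Set.univ) (x := 1)
      (fun z _ => differentiable_xi.analyticAt z) isPreconnected_univ trivial trivial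
      (by rw [(differentiable_xi.analyticAt 1).analyticOrderAt_eq_zero.mpr (by simp [xi_one])]
          simp)
  have h0 : analyticOrderAt xi ρ ≠ 0 := by
    rw [(differentiable_xi.analyticAt _).analyticOrderAt_ne_zero, xi_eq_zero_iff]
    exact ρ.2
  simp [analyticOrderNatAt, hord, h0]

/-- As the real parts of `ρ` and `1 - ρ` lie in `(0, 1)`, their squares may be replaced by 1 in the
denominators; the numerators add up to 1. -/
theorem inv_one_add_im_sq_le :
    1 / (1 + (ρ : ℂ).im ^ 2) ≤ (1 / (ρ : ℂ) + 1 / (1 - (ρ : ℂ))).re := by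
  obtain ⟨-, h0, h1⟩ := ρ.2
  have h2 : (1 / (ρ : ℂ)).re = (ρ : ℂ).re / ((ρ : ℂ).re ^ 2 + (ρ : ℂ).im ^ 2) := by
    simp [Complex.normSq_apply, ← sq]
  have h3 : (1 / (1 - (ρ : ℂ))).re =
      (1 - (ρ : ℂ).re) / ((1 - (ρ : ℂ).re) ^ 2 + (ρ : ℂ).im ^ 2) := by
    simp [Complex.normSq_apply, ← sq]
  rw [Complex.add_re, h2, h3]
  have h4 : (ρ : ℂ).re / (1 + (ρ : ℂ).im ^ 2) ≤
      (ρ : ℂ).re / ((ρ : ℂ).re ^ 2 + (ρ : ℂ).im ^ 2) := by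
    gcongr
    nlinarith
  have h5 : (1 - (ρ : ℂ).re) / (1 + (ρ : ℂ).im ^ 2) ≤
      (1 - (ρ : ℂ).re) / ((1 - (ρ : ℂ).re) ^ 2 + (ρ : ℂ).im ^ 2) := by
    have : 0 < 1 - (ρ : ℂ).re := by linarith
    gcongr
    nlinarith
  have h6 : 1 / (1 + (ρ : ℂ).im ^ 2) =
      (ρ : ℂ).re / (1 + (ρ : ℂ).im ^ 2) + (1 - (ρ : ℂ).re) / (1 + (ρ : ℂ).im ^ 2) := by ring
  linarith

/-- The difference of logarithmic derivatives at `0` and `1`, which are opposite by the symmetry of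
`xi`. -/
theorem tendsto_sum_inv_add_inv :
    Tendsto (fun n => ∑ ρ ∈ nontrivialZerosNear n,
      (zeroMult ρ : ℂ) * (1 / (ρ : ℂ) + 1 / (1 - (ρ : ℂ)))) atTop (𝓝 (2 * liConst)) := by
  obtain ⟨B, hB⟩ := exists_slowGrowth_xi
  have h := (hB.tendsto_sum_inv_sub_inv (z := 0) (by simp [xi_zero])).neg
  rw [logDeriv_xi_one, logDeriv_xi_zero] at h
  refine (h.congr fun n => ?_).trans (le_of_eq (by congr 1; ring))
  rw [sum_zerosNear n fun a => 1 / (0 - a) - 1 / (1 - a), ← Finset.sum_neg_distrib]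
  refine Finset.sum_congr rfl fun ρ _ => ?_
  rw [zero_sub, one_div_neg_eq_neg_one_div]
  ring

theorem hasSum_re_inv_add_inv :
    HasSum (fun ρ : NontrivialZeros =>
      (zeroMult ρ : ℝ) * (1 / (ρ : ℂ) + 1 / (1 - (ρ : ℂ))).re) (2 * liConst) := by
  refine hasSum_of_tendsto_of_nonneg tendsto_nontrivialZerosNear (fun ρ => ?_) ?_
  · have h := inv_one_add_im_sq_le ρ
    have : 0 ≤ 1 / (1 + (ρ : ℂ).im ^ 2) := by positivity
    exact mul_nonneg (Nat.cast_nonneg _) (this.trans h)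
  · have h := (Complex.continuous_re.tendsto _).comp tendsto_sum_inv_add_inv
    have e : ((2 : ℂ) * liConst).re = 2 * liConst := by simp
    rw [e] at h
    refine h.congr fun n => ?_
    rw [Function.comp_apply, Complex.re_sum]
    refine Finset.sum_congr rfl fun ρ _ => ?_
    rw [← Complex.ofReal_natCast, Complex.re_ofReal_mul]

theorem liConst_nonneg : 0 ≤ liConst := by
  have := hasSum_re_inv_add_inv.nonneg fun ρ =>
    mul_nonneg (Nat.cast_nonneg (zeroMult ρ))
      ((by positivity : 0 ≤ 1 / (1 + (ρ : ℂ).im ^ 2)).trans (inv_one_add_im_sq_le ρ))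
  linarith

/-- The bound `1 / 20` is what `2 * liConst < 1 / (1 + 3 ^ 2)` requires. Euler's constant is bounded
through the harmonic sum of 16 terms, `log π` through `π / e`. -/
theorem liConst_lt : liConst < 1 / 20 := by
  have h1 : Real.eulerMascheroniConstant < 0.6085 := by
    refine (Real.eulerMascheroniConstant_lt_eulerMascheroniSeq' 16).trans ?_
    have hl : Real.log (16 : ℕ) = 4 * Real.log 2 := by
      rw [show ((16 : ℕ) : ℝ) = 2 ^ 4 by norm_num, Real.log_pow]
      norm_num
    rw [Real.eulerMascheroniSeq', if_neg (by norm_num), hl]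
    have := Real.log_two_gt_d9
    have hh : (harmonic 16 : ℝ) < 3.381 := by
      simp only [harmonic, Finset.sum_range_succ, Finset.sum_range_zero]
      norm_num
    linarith
  have h2 : Real.log (2 * Real.sqrt Real.pi) = Real.log 2 + Real.log Real.pi / 2 := by
    rw [Real.log_mul (by norm_num) (by positivity), Real.log_sqrt Real.pi_pos.le]
  have h3 : 1.13 < Real.log Real.pi := by
    have e : Real.log Real.pi = 1 + Real.log (Real.pi / Real.exp 1) := by
      rw [Real.log_div Real.pi_ne_zero (Real.exp_ne_zero _), Real.log_exp]
      ring
    have h4 := Real.one_sub_inv_le_log_of_pos (x := Real.pi / Real.exp 1) (by positivity)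
    have h5 : Real.exp 1 / Real.pi < 0.87 := by
      rw [div_lt_iff₀ Real.pi_pos]
      linarith [Real.exp_one_lt_d9, Real.pi_gt_d2]
    rw [inv_div] at h4
    linarith
  have h6 := Real.log_two_gt_d9
  rw [liConst, h2]
  linarith

/-- One term of a series of nonnegative terms is at most the whole sum, here less than `1 / 10`. -/
theorem nine_lt_im_sq : 9 < (ρ : ℂ).im ^ 2 := by
  have h := hasSum_re_inv_add_inv
  have hnn : ∀ ρ : NontrivialZeros, 0 ≤ (1 / (ρ : ℂ) + 1 / (1 - (ρ : ℂ))).re := fun ρ =>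
    (by positivity : 0 ≤ 1 / (1 + (ρ : ℂ).im ^ 2)).trans (inv_one_add_im_sq_le ρ)
  have h1 := le_hasSum h ρ fun ρ _ => mul_nonneg (Nat.cast_nonneg _) (hnn ρ)
  have h2 : (1 : ℝ) ≤ zeroMult ρ := by exact_mod_cast one_le_zeroMult ρ
  have h3 := inv_one_add_im_sq_le ρ
  have h4 : 1 / (1 + (ρ : ℂ).im ^ 2) < 1 / 10 := by
    nlinarith [hnn ρ, liConst_lt]
  have := lt_of_one_div_lt_one_div (by positivity) h4
  linarith

theorem mult_div_im_sq_le :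
    (zeroMult ρ : ℝ) / (ρ : ℂ).im ^ 2 ≤
      10 / 9 * ((zeroMult ρ : ℝ) * (1 / (ρ : ℂ) + 1 / (1 - (ρ : ℂ))).re) := by
  have h9 := nine_lt_im_sq ρ
  have h1 : 1 / (ρ : ℂ).im ^ 2 ≤ 10 / 9 * (1 / (1 + (ρ : ℂ).im ^ 2)) := by
    rw [mul_one_div, div_le_div_iff₀ (by linarith) (by linarith)]
    linarith
  have h2 := inv_one_add_im_sq_le ρ
  have hm : (0 : ℝ) ≤ zeroMult ρ := Nat.cast_nonneg _
  calc (zeroMult ρ : ℝ) / (ρ : ℂ).im ^ 2 = zeroMult ρ * (1 / (ρ : ℂ).im ^ 2) := by ring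
    _ ≤ zeroMult ρ * (10 / 9 * (1 / (ρ : ℂ) + 1 / (1 - (ρ : ℂ))).re) := by
        gcongr
        linarith
    _ = _ := by ring

theorem summable_mult_div_im_sq :
    Summable fun ρ : NontrivialZeros => (zeroMult ρ : ℝ) / (ρ : ℂ).im ^ 2 :=
  Summable.of_nonneg_of_le (fun ρ => by positivity) mult_div_im_sq_le
    (hasSum_re_inv_add_inv.summable.mul_left _)

theorem tsum_mult_div_im_sq_le :
    ∑' ρ : NontrivialZeros, (zeroMult ρ : ℝ) / (ρ : ℂ).im ^ 2 ≤ 20 / 9 * liConst := by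
  have := summable_mult_div_im_sq.tsum_le_tsum mult_div_im_sq_le
    (hasSum_re_inv_add_inv.summable.mul_left _)
  rw [tsum_mul_left, hasSum_re_inv_add_inv.tsum_eq] at this
  linarith

theorem im_abs_le_norm_one_sub : |(ρ : ℂ).im| ≤ ‖1 - (ρ : ℂ)‖ := by
  simpa using Complex.abs_im_le_norm (1 - (ρ : ℂ))

theorem three_lt_abs_im : 3 < |(ρ : ℂ).im| := by
  have h : (3 : ℝ) ^ 2 < |(ρ : ℂ).im| ^ 2 := by
    rw [sq_abs]
    linarith [nine_lt_im_sq ρ]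
  exact lt_of_pow_lt_pow_left₀ 2 (abs_nonneg _) h

/-- A bound of `1 / w ^ (k + 1)` for `w` with the imaginary part, up to sign, of a zero. -/
theorem inv_norm_pow_le {w : ℂ} (hw : |(ρ : ℂ).im| ≤ ‖w‖) {k : ℕ} (hk : 1 ≤ k) :
    1 / ‖w‖ ^ (k + 1) ≤ 1 / (ρ : ℂ).im ^ 2 * (9 / 3 ^ (k + 1)) := by
  have h3 := three_lt_abs_im ρ
  obtain ⟨j, rfl⟩ := Nat.exists_eq_add_of_le' hk
  have h2 : |(ρ : ℂ).im| ^ 2 ≤ ‖w‖ ^ 2 := by gcongr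
  have h4 : (3 : ℝ) ^ j ≤ ‖w‖ ^ j := by
    gcongr
    linarith
  have h5 : 1 / (ρ : ℂ).im ^ 2 * (9 / 3 ^ (j + 1 + 1)) = 1 / (|(ρ : ℂ).im| ^ 2 * 3 ^ j) := by
    rw [sq_abs]
    have := nine_lt_im_sq ρ
    field_simp
    ring
  rw [h5, show j + 1 + 1 = 2 + j by ring, pow_add]
  gcongr

theorem norm_mult_div_pow_le {w : ℂ} (hw : |(ρ : ℂ).im| ≤ ‖w‖) {k : ℕ} (hk : 1 ≤ k) :
    ‖(zeroMult ρ : ℂ) * (1 / w ^ (k + 1))‖ ≤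
      (zeroMult ρ : ℝ) / (ρ : ℂ).im ^ 2 * (9 / 3 ^ (k + 1)) := by
  rw [norm_mul, norm_div, norm_one, norm_pow, Complex.norm_natCast]
  have := inv_norm_pow_le ρ hw hk
  calc _ ≤ (zeroMult ρ : ℝ) * (1 / (ρ : ℂ).im ^ 2 * (9 / 3 ^ (k + 1))) := by gcongr
    _ = _ := by ring

theorem hasSum_inv_one_sub_pow {k : ℕ} (hk : 1 ≤ k) :
    HasSum (fun ρ : NontrivialZeros => (zeroMult ρ : ℂ) * (1 / (1 - (ρ : ℂ)) ^ (k + 1)))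
      ((-1) ^ k / k.factorial * iteratedDeriv k (logDeriv xi) 1) := by
  obtain ⟨B, hB⟩ := exists_slowGrowth_xi
  have hs : Summable fun ρ : NontrivialZeros =>
      (zeroMult ρ : ℂ) * (1 / (1 - (ρ : ℂ)) ^ (k + 1)) :=
    Summable.of_norm_bounded (summable_mult_div_im_sq.mul_right _) fun ρ =>
      norm_mult_div_pow_le ρ (im_abs_le_norm_one_sub ρ) hk
  have h := hB.tendsto_sum_inv_pow hk
  have h' : Tendsto (fun n => ∑ ρ ∈ nontrivialZerosNear n,
      (zeroMult ρ : ℂ) * (1 / (1 - (ρ : ℂ)) ^ (k + 1))) atTop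
      (𝓝 ((-1) ^ k / k.factorial * iteratedDeriv k (logDeriv xi) 1)) := by
    refine h.congr fun n => ?_
    rw [← sum_zerosNear n fun a => 1 / (1 - a) ^ (k + 1)]
    simp only [mul_one_div]
  rw [← tendsto_nhds_unique (hs.hasSum.comp tendsto_nontrivialZerosNear) h']
  exact hs.hasSum

/-- The involution `ρ ↦ 1 - ρ` of the nontrivial zeros. -/
def oneSubEquiv : NontrivialZeros ≃ NontrivialZeros where
  toFun ρ := ⟨1 - ρ, one_sub_mem_nontrivialZeros ρ.2⟩
  invFun ρ := ⟨1 - ρ, one_sub_mem_nontrivialZeros ρ.2⟩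
  left_inv ρ := by simp
  right_inv ρ := by simp

theorem hasSum_inv_pow {k : ℕ} (hk : 1 ≤ k) :
    HasSum (fun ρ : NontrivialZeros => (zeroMult ρ : ℂ) * (1 / (ρ : ℂ) ^ (k + 1)))
      ((-1) ^ k / k.factorial * iteratedDeriv k (logDeriv xi) 1) := by
  have e : (fun ρ : NontrivialZeros => (zeroMult ρ : ℂ) * (1 / (ρ : ℂ) ^ (k + 1))) =
      (fun ρ : NontrivialZeros => (zeroMult ρ : ℂ) * (1 / (1 - (ρ : ℂ)) ^ (k + 1))) ∘
        oneSubEquiv := by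
    funext ρ
    simp [oneSubEquiv, zeroMult, analyticOrderNatAt_one_sub ρ.2]
  rw [e, oneSubEquiv.hasSum_iff]
  exact hasSum_inv_one_sub_pow hk

/-- Pairing gives `1 / (ρ (1 - ρ))`, of quadratic decay; this is where the pairing of the zeros is
used. -/
theorem norm_mult_inv_add_inv_le :
    ‖(zeroMult ρ : ℂ) * (1 / (ρ : ℂ) + 1 / (1 - (ρ : ℂ)))‖ ≤
      (zeroMult ρ : ℝ) / (ρ : ℂ).im ^ 2 := by
  have h0 := zero_ne_zero ρ
  have h1 := one_sub_zero_ne_zero ρ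
  have e : 1 / (ρ : ℂ) + 1 / (1 - (ρ : ℂ)) = 1 / (ρ * (1 - ρ)) := by
    field_simp
    ring
  have h3 := three_lt_abs_im ρ
  have h4 := Complex.abs_im_le_norm (ρ : ℂ)
  have h5 := im_abs_le_norm_one_sub ρ
  rw [e, mul_one_div, norm_div, norm_mul, Complex.norm_natCast, ← sq_abs, sq]
  have : 0 < |(ρ : ℂ).im| * |(ρ : ℂ).im| := by positivity
  gcongr

theorem hasSum_inv_add_inv :
    HasSum (fun ρ : NontrivialZeros => (zeroMult ρ : ℂ) * (1 / (ρ : ℂ) + 1 / (1 - (ρ : ℂ))))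
      (2 * liConst) := by
  have hs : Summable fun ρ : NontrivialZeros =>
      (zeroMult ρ : ℂ) * (1 / (ρ : ℂ) + 1 / (1 - (ρ : ℂ))) :=
    Summable.of_norm_bounded summable_mult_div_im_sq norm_mult_inv_add_inv_le
  rw [← tendsto_nhds_unique (hs.hasSum.comp tendsto_nontrivialZerosNear) tendsto_sum_inv_add_inv]
  exact hs.hasSum

/-! ### Taylor coefficients of the logarithmic derivative of the Gamma factor -/

/-- Cauchy's integral for the derivative and dominated convergence: on the circle, pointwise
convergence with a uniform bound is enough. -/
theorem tendsto_deriv_of_tendsto_of_bounded {G : ℕ → ℂ → ℂ} {g : ℂ → ℂ} {U : Set ℂ}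
    (hU : IsOpen U) {z : ℂ} {r M : ℝ} (hr : 0 < r) (hzU : closedBall z r ⊆ U)
    (hG : ∀ n, DifferentiableOn ℂ (G n) U) (hg : DifferentiableOn ℂ g U)
    (hM : ∀ᶠ n in atTop, ∀ w ∈ sphere z r, ‖G n w‖ ≤ M)
    (hlim : ∀ w ∈ sphere z r, Tendsto (fun n => G n w) atTop (𝓝 (g w))) :
    Tendsto (fun n => deriv (G n) z) atTop (𝓝 (deriv g z)) := by
  rw [← Complex.cderiv_eq_deriv hU hg hr hzU]
  simp only [← Complex.cderiv_eq_deriv hU (hG _) hr hzU]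
  refine Tendsto.const_smul ?_ _
  have hs : ∀ θ : ℝ, circleMap z r θ ∈ sphere z r := fun θ => circleMap_mem_sphere z hr.le θ
  have hcont : ∀ n, Continuous fun θ : ℝ => G n (circleMap z r θ) := fun n =>
    (hG n).continuousOn.comp_continuous (continuous_circleMap z r)
      fun θ => hzU (sphere_subset_closedBall (hs θ))
  refine intervalIntegral.tendsto_integral_filter_of_dominated_convergence
    (fun _ => r * ((r ^ 2)⁻¹ * M)) ?_ ?_ ?_ ?_
  · refine Eventually.of_forall fun n => Continuous.aestronglyMeasurable ?_
    have h1 : Continuous fun θ : ℝ => ((circleMap z r θ - z) ^ 2)⁻¹ := by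
      refine Continuous.inv₀ (by fun_prop) fun θ => pow_ne_zero _ ?_
      rw [circleMap_sub_center]
      exact circleMap_ne_center hr.ne'
    simp only [deriv_circleMap]
    exact ((continuous_circleMap 0 r).mul continuous_const).smul (h1.smul (hcont n))
  · filter_upwards [hM] with n hn
    refine Eventually.of_forall fun θ _ => ?_
    rw [norm_smul, norm_smul, norm_inv, norm_pow]
    have h1 : ‖circleMap z r θ - z‖ = r := by simpa [dist_eq_norm] using hs θ
    have h2 : ‖deriv (circleMap z r) θ‖ = r := by simp [abs_of_pos hr]
    rw [h1, h2]
    gcongr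
    exact hn _ (hs θ)
  · exact intervalIntegrable_const
  · refine Eventually.of_forall fun θ _ => ?_
    exact ((hlim _ (hs θ)).const_smul _).const_smul _

/-- The norm is at most the value at the real part, which log-convexity of Gamma (Bohr–Mollerup)
keeps below Gamma itself. -/
theorem norm_GammaSeq_le {s : ℂ} (hs : 0 < s.re) {n : ℕ} (hn : n ≠ 0) :
    ‖Complex.GammaSeq s n‖ ≤ Real.Gamma s.re := by
  have hn' : 0 < n := Nat.pos_of_ne_zero hn
  have hnR : (0 : ℝ) < n := by exact_mod_cast hn'
  have hpos : ∀ j : ℕ, 0 < s.re + j := fun j => by positivity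
  have hprod : 0 < ∏ j ∈ Finset.range (n + 1), (s.re + j) :=
    Finset.prod_pos fun j _ => hpos j
  have h1 : ‖Complex.GammaSeq s n‖ ≤
      (n : ℝ) ^ s.re * n.factorial / ∏ j ∈ Finset.range (n + 1), (s.re + j) := by
    rw [Complex.GammaSeq, norm_div, norm_mul, Complex.norm_natCast_cpow_of_pos hn',
      Complex.norm_natCast, norm_prod]
    gcongr with j _
    refine le_trans (le_of_eq ?_) (Complex.re_le_norm (s + j))
    simp
  refine h1.trans ?_
  have h2 := Real.BohrMollerup.ge_logGammaSeq Real.convexOn_log_Gamma (fun {y} hy => by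
    rw [Function.comp_apply, Real.Gamma_add_one hy.ne', Real.log_mul hy.ne'
      (Real.Gamma_pos_of_pos hy).ne', add_comm, Function.comp_apply]) hs hn
  rw [Function.comp_apply, Real.Gamma_one, Real.log_one, zero_add, Function.comp_apply,
    Real.BohrMollerup.logGammaSeq] at h2
  rw [← Real.log_le_log_iff (by positivity) (Real.Gamma_pos_of_pos hs),
    Real.log_div (by positivity) hprod.ne', Real.log_mul (by positivity) (by positivity),
    Real.log_rpow hnR, Real.log_prod fun j _ => (hpos j).ne']
  exact h2

theorem hasSum_nat_of_tendsto_range_succ {u : ℕ → ℂ} (hu : Summable u) {L : ℂ}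
    (h : Tendsto (fun n => ∑ j ∈ Finset.range (n + 1), u j) atTop (𝓝 L)) : HasSum u L := by
  rw [← tendsto_nhds_unique (hu.hasSum.tendsto_sum_nat.comp (tendsto_add_atTop_nat 1)) h]
  exact hu.hasSum

/-- Logarithmic derivative of Euler's limit `GammaSeq`; the derivatives converge by
`tendsto_deriv_of_tendsto_of_bounded`. -/
theorem tendsto_log_sub_sum_digamma {z : ℂ} (hz : 0 < z.re) :
    Tendsto (fun n : ℕ => Complex.log n - ∑ j ∈ Finset.range (n + 1), 1 / (z + j)) atTop
      (𝓝 (Complex.digamma z)) := by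
  set U : Set ℂ := {w | 0 < w.re}
  have hU : IsOpen U := isOpen_lt continuous_const Complex.continuous_re
  have hne : ∀ w ∈ U, ∀ j : ℕ, w + j ≠ 0 := by
    intro w (hw : 0 < w.re) j h
    have := congrArg Complex.re h
    simp at this
    linarith [j.cast_nonneg (α := ℝ)]
  have hr : 0 < z.re / 2 := by linarith
  have hre : ∀ w ∈ closedBall z (z.re / 2), 0 < w.re := by
    intro w hw
    have h1 : ‖w - z‖ ≤ z.re / 2 := by simpa [dist_eq_norm] using hw
    have h2 := (Complex.abs_re_le_norm (w - z)).trans h1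
    rw [Complex.sub_re, abs_le] at h2
    linarith [h2.1]
  obtain ⟨M, hM⟩ := (isCompact_sphere z (z.re / 2)).exists_bound_of_continuousOn
    (f := fun w : ℂ => Real.Gamma w.re) (by
      intro w hw
      have hw' := hre w (sphere_subset_closedBall hw)
      have h1 : ContinuousAt Real.Gamma w.re :=
        (Real.differentiableAt_Gamma fun m => by
          have := m.cast_nonneg (α := ℝ)
          linarith).continuousAt
      exact (h1.comp Complex.continuous_re.continuousAt).continuousWithinAt)
  have hdG : ∀ n : ℕ, ∀ w ∈ U, HasDerivAt (fun w => Complex.GammaSeq w (n + 1))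
      (Complex.GammaSeq w (n + 1) * (Complex.log (n + 1 : ℕ) -
        ∑ j ∈ Finset.range (n + 1 + 1), 1 / (w + j))) w := by
    intro n w hw
    have hn0 : ((n + 1 : ℕ) : ℂ) ≠ 0 := by exact_mod_cast n.succ_ne_zero
    have hp : ∀ j ∈ Finset.range (n + 1 + 1), w + (j : ℂ) ≠ 0 := fun j _ => hne w hw j
    have hp' : ∏ j ∈ Finset.range (n + 1 + 1), (w + (j : ℂ)) ≠ 0 := Finset.prod_ne_zero_iff.mpr hp
    have hd : DifferentiableAt ℂ (fun w => Complex.GammaSeq w (n + 1)) w := by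
      unfold Complex.GammaSeq
      refine DifferentiableAt.div (DifferentiableAt.mul ?_ (by fun_prop)) (by fun_prop) hp'
      exact differentiableAt_id.const_cpow (Or.inl hn0)
    have hc : HasDerivAt (fun w : ℂ => ((n + 1 : ℕ) : ℂ) ^ w)
        (((n + 1 : ℕ) : ℂ) ^ w * Complex.log (n + 1 : ℕ)) w := by
      simpa using (hasDerivAt_id w).const_cpow (c := ((n + 1 : ℕ) : ℂ)) (Or.inl hn0)
    have hcw : ((n + 1 : ℕ) : ℂ) ^ w ≠ 0 := fun h => hn0 ((Complex.cpow_eq_zero_iff _ _).mp h).1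
    have hfac : ((n + 1).factorial : ℂ) ≠ 0 := by exact_mod_cast (n + 1).factorial_ne_zero
    have hl : logDeriv (fun w => Complex.GammaSeq w (n + 1)) w =
        Complex.log (n + 1 : ℕ) - ∑ j ∈ Finset.range (n + 1 + 1), 1 / (w + j) := by
      unfold Complex.GammaSeq
      rw [logDeriv_div (f := fun w : ℂ => ((n + 1 : ℕ) : ℂ) ^ w * (n + 1).factorial)
        (g := fun w : ℂ => ∏ j ∈ Finset.range (n + 1 + 1), (w + (j : ℂ))) w
        (mul_ne_zero hcw hfac) hp' (hc.differentiableAt.mul_const _) (by fun_prop),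
        logDeriv_mul_const w _ hfac, logDeriv_prod hp (fun j _ => by fun_prop)]
      congr 1
      · rw [logDeriv_apply, hc.deriv, mul_div_cancel_left₀ _ hcw]
      · refine Finset.sum_congr rfl fun j _ => ?_
        simp [logDeriv_apply]
    have hG0 : Complex.GammaSeq w (n + 1) ≠ 0 := by
      unfold Complex.GammaSeq
      exact div_ne_zero (mul_ne_zero hcw hfac) hp'
    rw [← hl, logDeriv_apply, mul_div_cancel₀ _ hG0]
    exact hd.hasDerivAt
  have hzU : z ∈ U := hz
  have hΓ : ∀ w ∈ U, DifferentiableAt ℂ Complex.Gamma w := fun w hw =>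
    Complex.differentiableAt_Gamma w fun m h => hne w hw m (by rw [h]; ring)
  have hΓ0 : Complex.Gamma z ≠ 0 := Complex.Gamma_ne_zero_of_re_pos hz
  have h1 := tendsto_deriv_of_tendsto_of_bounded (G := fun n w => Complex.GammaSeq w (n + 1))
    (g := Complex.Gamma) hU hr hre
    (fun n w hw => (hdG n w hw).differentiableAt.differentiableWithinAt)
    (fun w hw => (hΓ w hw).differentiableWithinAt)
    (Eventually.of_forall fun n w hw =>
      (norm_GammaSeq_le (hre w (sphere_subset_closedBall hw)) n.succ_ne_zero).trans
        ((le_abs_self _).trans (hM w hw)))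
    (fun w _ => (Complex.GammaSeq_tendsto_Gamma w).comp (tendsto_add_atTop_nat 1))
  have h2 : Tendsto (fun n => Complex.GammaSeq z (n + 1)) atTop (𝓝 (Complex.Gamma z)) :=
    (Complex.GammaSeq_tendsto_Gamma z).comp (tendsto_add_atTop_nat 1)
  have h3 := h1.div h2 hΓ0
  rw [← tendsto_add_atTop_iff_nat 1]
  refine h3.congr' ?_
  filter_upwards [h2.eventually_ne hΓ0] with n hn
  rw [Pi.div_apply, (hdG n z hzU).deriv, mul_div_cancel_left₀ _ hn]

/-- The sum of `1 / n ^ (k + 1)` over the odd `n ≥ 3`. -/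
def oddSum (k : ℕ) : ℝ := ∑' j : ℕ, 1 / (2 * j + 3 : ℝ) ^ (k + 1)

theorem summable_oddSum {k : ℕ} (hk : 1 ≤ k) :
    Summable fun j : ℕ => 1 / (2 * j + 3 : ℝ) ^ (k + 1) := by
  have h : Summable fun j : ℕ => 1 / ((j + 1 : ℕ) : ℝ) ^ (k + 1) :=
    (summable_nat_add_iff 1).mpr (Real.summable_one_div_nat_pow.mpr (by lia))
  refine Summable.of_nonneg_of_le (fun j => by positivity) (fun j => ?_) h
  gcongr
  push_cast
  linarith [j.cast_nonneg (α := ℝ)]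

theorem logDeriv_Gammaℝ_add_two {s : ℂ} (hs : 0 < s.re) :
    logDeriv (fun s : ℂ => Complex.Gammaℝ (s + 2)) s =
      -(Complex.log Real.pi) / 2 + Complex.digamma (s / 2 + 1) / 2 := by
  have hpi : (Real.pi : ℂ) ≠ 0 := by exact_mod_cast Real.pi_ne_zero
  have e : (fun s : ℂ => Complex.Gammaℝ (s + 2)) =
      fun s => (Real.pi : ℂ) ^ (-(s + 2) / 2) * Complex.Gamma (s / 2 + 1) := by
    funext s
    rw [Complex.Gammaℝ_def, show (s + 2) / 2 = s / 2 + 1 by ring]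
  have hre : 0 < (s / 2 + 1).re := by simp; linarith
  have hc : HasDerivAt (fun s : ℂ => (Real.pi : ℂ) ^ (-(s + 2) / 2))
      ((Real.pi : ℂ) ^ (-(s + 2) / 2) * Complex.log Real.pi * (-1 / 2)) s := by
    exact (((hasDerivAt_id s).add_const 2).neg.div_const 2).const_cpow (Or.inl hpi)
  have hΓ : DifferentiableAt ℂ Complex.Gamma (s / 2 + 1) :=
    Complex.differentiableAt_Gamma _ fun m h => by
      rw [h] at hre
      simp at hre
      linarith [m.cast_nonneg (α := ℝ)]
  have hi : HasDerivAt (fun s : ℂ => s / 2 + 1) (1 / 2) s :=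
    ((hasDerivAt_id s).div_const 2).add_const 1
  have hg : HasDerivAt (fun s : ℂ => Complex.Gamma (s / 2 + 1))
      (deriv Complex.Gamma (s / 2 + 1) * (1 / 2)) s := hΓ.hasDerivAt.comp s hi
  have hcs : (Real.pi : ℂ) ^ (-(s + 2) / 2) ≠ 0 := by simp [Complex.cpow_eq_zero_iff, hpi]
  rw [e, logDeriv_mul (f := fun s : ℂ => (Real.pi : ℂ) ^ (-(s + 2) / 2))
    (g := fun s : ℂ => Complex.Gamma (s / 2 + 1)) s hcs (Complex.Gamma_ne_zero_of_re_pos hre) hc.differentiableAt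
    hg.differentiableAt, logDeriv_apply, logDeriv_apply, hc.deriv, hg.deriv, Complex.digamma_def,
    logDeriv_apply]
  field_simp

theorem hasSum_logDeriv_Gammaℝ {w : ℂ} (hw : ‖w‖ < 1) :
    HasSum (fun k : ℕ => w ^ (k + 1) * ((-1) ^ k * (oddSum (k + 1) : ℂ)))
      (logDeriv (fun s : ℂ => Complex.Gammaℝ (s + 2)) (1 + w) -
        logDeriv (fun s : ℂ => Complex.Gammaℝ (s + 2)) 1) := by
  have hre : 0 < (1 + w).re := by
    have := (Complex.abs_re_le_norm w).trans_lt hw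
    simp
    linarith [(abs_lt.mp this).1]
  set T : ℕ × ℕ → ℂ := fun p => (-1) ^ p.2 * w ^ (p.2 + 1) * (1 / (2 * p.1 + 3 : ℂ) ^ (p.2 + 2))
  have hnorm : ∀ j : ℕ, ‖(2 * j + 3 : ℂ)‖ = 2 * j + 3 := fun j => by
    have : (2 * j + 3 : ℂ) = ((2 * j + 3 : ℕ) : ℂ) := by push_cast; ring
    rw [this, Complex.norm_natCast]
    push_cast
    ring
  have hT : Summable T := by
    have h1 : Summable fun j : ℕ => 1 / (2 * j + 3 : ℝ) ^ 2 :=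
      summable_oddSum (k := 1) le_rfl
    have h2 : Summable fun k : ℕ => ‖w‖ ^ (k + 1) :=
      (summable_nat_add_iff 1).mpr (summable_geometric_of_lt_one (norm_nonneg _) hw)
    refine Summable.of_norm_bounded (h1.mul_of_nonneg h2 (fun j => by positivity)
      fun k => by positivity) fun p => ?_
    simp only [T, norm_mul, norm_pow, norm_neg, norm_one, one_pow, one_mul, norm_div, hnorm]
    rw [mul_comm]
    have : (1 : ℝ) ≤ 2 * p.1 + 3 := by linarith [p.1.cast_nonneg (α := ℝ)]
    gcongr
    lia
  have hrow : ∀ j : ℕ, HasSum (fun k => T (j, k)) (1 / (2 * j + 3 : ℂ) - 1 / (2 * j + 3 + w)) := by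
    intro j
    set a : ℂ := 2 * j + 3
    have han : 3 ≤ ‖a‖ := by rw [hnorm]; linarith [j.cast_nonneg (α := ℝ)]
    have ha : a ≠ 0 := norm_pos_iff.mp (by linarith)
    have haw : a + w ≠ 0 := by
      intro h
      have : ‖a‖ = ‖w‖ := by rw [eq_neg_of_add_eq_zero_left h, norm_neg]
      linarith
    have hq : ‖-(w / a)‖ < 1 := by
      rw [norm_neg, norm_div, div_lt_one (by linarith)]
      linarith
    have h := (hasSum_geometric_of_norm_lt_one hq).mul_left (w / a ^ 2)
    have e1 : w / a ^ 2 * (1 - -(w / a))⁻¹ = 1 / a - 1 / (a + w) := by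
      have : 1 - -(w / a) = (a + w) / a := by field_simp; ring
      rw [this]
      field_simp
      ring
    rw [e1] at h
    refine h.congr_fun fun k => ?_
    have e2 : T (j, k) = (-1) ^ k * w ^ (k + 1) * (1 / a ^ (k + 2)) := rfl
    rw [e2, neg_pow (w / a) k, div_pow]
    field_simp
    ring
  have hcol : ∀ k : ℕ, HasSum (fun j => T (j, k))
      (w ^ (k + 1) * ((-1) ^ k * (oddSum (k + 1) : ℂ))) := by
    intro k
    have h := (Complex.hasSum_ofReal.mpr
      (summable_oddSum (k := k + 1) (by lia)).hasSum).mul_left ((-1) ^ k * w ^ (k + 1))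
    have e : w ^ (k + 1) * ((-1) ^ k * (oddSum (k + 1) : ℂ)) =
        (-1) ^ k * w ^ (k + 1) * (oddSum (k + 1) : ℂ) := by ring
    rw [e]
    refine h.congr_fun fun j => ?_
    simp only [T]
    push_cast
    ring
  have hrows := hT.hasSum.prod_fiberwise hrow
  have hT' := (Equiv.prodComm ℕ ℕ).hasSum_iff.mpr hT.hasSum
  have hcols := hT'.prod_fiberwise hcol
  -- In the difference of two digamma values `log n` cancels, leaving the row sums; the column sums
  -- of the same double series are then the Taylor terms in `w`.
  have hlim : HasSum (fun j : ℕ => 1 / (2 * j + 3 : ℂ) - 1 / (2 * j + 3 + w))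
      (logDeriv (fun s : ℂ => Complex.Gammaℝ (s + 2)) (1 + w) -
        logDeriv (fun s : ℂ => Complex.Gammaℝ (s + 2)) 1) := by
    refine hasSum_nat_of_tendsto_range_succ hrows.summable ?_
    have h1 := tendsto_log_sub_sum_digamma (z := (1 + w) / 2 + 1)
      (by simp at hre ⊢; linarith)
    have h2 := tendsto_log_sub_sum_digamma (z := 1 / 2 + 1) (by norm_num)
    rw [logDeriv_Gammaℝ_add_two hre, logDeriv_Gammaℝ_add_two (s := 1) (by simp)]
    have h3 := ((h1.sub h2).div_const 2)
    refine (h3.congr fun n => ?_).trans (le_of_eq (by congr 1; ring))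
    rw [sub_sub_sub_cancel_left, ← Finset.sum_sub_distrib, Finset.sum_div]
    refine Finset.sum_congr rfl fun j _ => ?_
    have e1 : (1 / 2 + 1 + j : ℂ) = (2 * j + 3) / 2 := by ring
    have e2 : ((1 + w) / 2 + 1 + j : ℂ) = (2 * j + 3 + w) / 2 := by ring
    rw [e1, e2, one_div_div, one_div_div]
    ring
  rw [← hrows.unique hlim]
  exact hcols

theorem iteratedDeriv_logDeriv_Gammaℝ {k : ℕ} (hk : 1 ≤ k) :
    iteratedDeriv k (logDeriv fun s : ℂ => Complex.Gammaℝ (s + 2)) 1 =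
      (-1) ^ (k + 1) * k.factorial * oddSum k := by
  set L := logDeriv fun s : ℂ => Complex.Gammaℝ (s + 2)
  have hG := analyticAt_Gammaℝ_add_two (s := 1) (by simp)
  have han : AnalyticAt ℂ L 1 :=
    hG.deriv.div hG (Gammaℝ_add_two_ne_zero (by simp))
  set a : ℕ → ℂ := fun n => if n = 0 then L 1 else (-1) ^ (n - 1) * (oddSum n : ℂ)
  have hser : HasFPowerSeriesAt L (FormalMultilinearSeries.ofScalars ℂ a) 1 := by
    rw [hasFPowerSeriesAt_iff]
    filter_upwards [ball_mem_nhds (0 : ℂ) one_pos] with w hw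
    have h := hasSum_logDeriv_Gammaℝ (w := w) (by simpa using hw)
    simp only [FormalMultilinearSeries.coeff_ofScalars, smul_eq_mul]
    rw [← hasSum_nat_add_iff' 1]
    simpa [a] using h
  have heq := hser.eq_formalMultilinearSeries han.hasFPowerSeriesAt
  have hc := congrArg (fun p => FormalMultilinearSeries.coeff p k) heq
  simp only [FormalMultilinearSeries.coeff_ofScalars] at hc
  have hkf : (k.factorial : ℂ) ≠ 0 := by exact_mod_cast k.factorial_ne_zero
  rw [eq_div_iff hkf] at hc
  rw [← hc]
  obtain ⟨j, rfl⟩ := Nat.exists_eq_add_of_le' hk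
  simp only [a, Nat.add_one_ne_zero, if_false, Nat.add_sub_cancel]
  ring

/-! ### The coefficients `eta` in terms of the zeros -/

theorem iteratedDeriv_logDeriv_xi {k : ℕ} (hk : 1 ≤ k) :
    (-1) ^ k / (k.factorial : ℂ) * iteratedDeriv k (logDeriv xi) 1 =
      ((-(oddSum k + (-1) ^ k * eta k) : ℝ) : ℂ) := by
  have hG := analyticAt_Gammaℝ_add_two (s := 1) (by simp)
  have hanG : AnalyticAt ℂ (logDeriv fun s : ℂ => Complex.Gammaℝ (s + 2)) 1 :=
    hG.deriv.div hG (Gammaℝ_add_two_ne_zero (by simp))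
  have hz := differentiable_riemannZeta₁.analyticAt 1
  have hanz : AnalyticAt ℂ (logDeriv riemannZeta₁) 1 := hz.deriv.div hz (by simp)
  have hkf : (k.factorial : ℂ) ≠ 0 := by exact_mod_cast k.factorial_ne_zero
  have heta := ofReal_eta k
  rw [eq_div_iff hkf] at heta
  rw [logDeriv_xi_eventuallyEq.iteratedDeriv_eq k,
    iteratedDeriv_fun_add hanG.contDiffAt hanz.contDiffAt, iteratedDeriv_logDeriv_Gammaℝ hk,
    ← neg_neg (iteratedDeriv k (logDeriv riemannZeta₁) 1), ← heta]
  have h2 : ((-1 : ℂ) ^ k) * (-1) ^ k = 1 := by rw [← mul_pow]; simp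
  push_cast
  field_simp
  rw [pow_succ]
  linear_combination (-(oddSum k : ℂ)) * h2

/-- The weights sum to at most `20 / 9 * liConst < 1 / 9`, which cancels the factor 9. -/
theorem norm_tsum_mult_le {g : NontrivialZeros → ℂ} {k : ℕ} {L : ℂ} (hg : HasSum g L)
    (h : ∀ ρ, ‖g ρ‖ ≤ (zeroMult ρ : ℝ) / (ρ : ℂ).im ^ 2 * (9 / 3 ^ (k + 1))) :
    ‖L‖ < 1 / 3 ^ (k + 1) := by
  have h1 := tsum_of_norm_bounded (summable_mult_div_im_sq.hasSum.mul_right (9 / 3 ^ (k + 1))) h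
  rw [hg.tsum_eq] at h1
  refine h1.trans_lt ?_
  have h2 : (0 : ℝ) < 1 / 3 ^ (k + 1) := by positivity
  have h3 := tsum_mult_div_im_sq_le
  have h4 := liConst_lt
  have e : (9 : ℝ) / 3 ^ (k + 1) = 9 * (1 / 3 ^ (k + 1)) := by ring
  rw [e]
  nlinarith

theorem abs_oddSum_add_eta_lt {k : ℕ} (hk : 1 ≤ k) :
    |oddSum k + (-1) ^ k * eta k| < 1 / 3 ^ (k + 1) := by
  have h := hasSum_inv_pow hk
  rw [iteratedDeriv_logDeriv_xi hk] at h
  have := norm_tsum_mult_le h fun ρ =>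
    norm_mult_div_pow_le ρ (Complex.abs_im_le_norm (ρ : ℂ)) hk
  rwa [Complex.norm_real, Real.norm_eq_abs, abs_neg] at this

theorem le_oddSum {k : ℕ} (hk : 1 ≤ k) : 1 / 3 ^ (k + 1) ≤ oddSum k := by
  have := (summable_oddSum hk).le_tsum 0 fun j _ => by positivity
  simpa [oddSum] using this

theorem oddSum_pos {k : ℕ} (hk : 1 ≤ k) : 0 < oddSum k :=
  lt_of_lt_of_le (by positivity) (le_oddSum hk)

theorem oddSum_le {k : ℕ} (hk : 1 ≤ k) : oddSum k ≤ 9 * oddSum 1 * (1 / 3 ^ (k + 1)) := by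
  have h := (summable_oddSum hk).tsum_le_tsum (g := fun j : ℕ =>
    1 / (2 * j + 3 : ℝ) ^ (1 + 1) * (9 * (1 / 3 ^ (k + 1)))) (fun j => ?_)
    ((summable_oddSum le_rfl).mul_right _)
  · rw [tsum_mul_right] at h
    calc oddSum k ≤ _ := h
      _ = _ := by simp only [oddSum]; ring
  · obtain ⟨i, rfl⟩ := Nat.exists_eq_add_of_le' hk
    have e : (9 : ℝ) * (1 / 3 ^ (i + 1 + 1)) = 1 / 3 ^ i := by field_simp; ring
    rw [e, one_div_mul_one_div, show i + 1 + 1 = (1 + 1) + i by ring, pow_add _ (1 + 1) i]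
    have : (3 : ℝ) ≤ 2 * j + 3 := by linarith [j.cast_nonneg (α := ℝ)]
    gcongr

theorem neg_one_pow_mul_eta_neg {k : ℕ} (hk : 1 ≤ k) : (-1) ^ k * eta k < 0 := by
  have h1 := (abs_lt.mp (abs_oddSum_add_eta_lt hk)).2
  have h2 := le_oddSum hk
  linarith

theorem abs_eta_le {k : ℕ} (hk : 1 ≤ k) : |eta k| ≤ (9 * oddSum 1 + 1) * (1 / 3 ^ (k + 1)) := by
  have h1 := (abs_lt.mp (abs_oddSum_add_eta_lt hk)).1
  have h2 := oddSum_le hk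
  have h3 := neg_one_pow_mul_eta_neg hk
  have e : |eta k| = -((-1) ^ k * eta k) := by
    rw [← abs_of_neg h3, abs_mul, abs_pow, abs_neg, abs_one, one_pow, one_mul]
  rw [e]
  linarith

/-- Removing the even `n` from the series of zeta gives the factor `1 - 2 ^ (-k - 1)`; the final `-
1` removes `n = 1`. -/
theorem oddSum_eq {k : ℕ} (hk : 1 ≤ k) :
    (1 - (2 : ℝ) ^ (-(k : ℤ) - 1)) * (riemannZeta ((k : ℂ) + 1)).re - 1 = oddSum k := by
  set S : ℝ := ∑' n : ℕ, 1 / (n : ℝ) ^ (k + 1)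
  have hS : Summable fun n : ℕ => 1 / (n : ℝ) ^ (k + 1) :=
    Real.summable_one_div_nat_pow.mpr (by lia)
  have hz : (riemannZeta ((k : ℂ) + 1)).re = S := by
    have := zeta_nat_eq_tsum_of_gt_one (k := k + 1) (by lia)
    push_cast at this
    rw [this, ← Complex.ofReal_re S]
    congr 1
    simp only [S]
    push_cast
    rfl
  have heven : ∀ n : ℕ, 1 / ((2 * n : ℕ) : ℝ) ^ (k + 1) =
      (1 / 2 ^ (k + 1)) * (1 / (n : ℝ) ^ (k + 1)) := fun n => by
    push_cast
    rw [mul_pow, one_div_mul_one_div]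
  have hodd : Summable fun n : ℕ => 1 / ((2 * n + 1 : ℕ) : ℝ) ^ (k + 1) :=
    hS.comp_injective (i := fun n : ℕ => 2 * n + 1) fun a b h => by simpa using h
  have h1 := tsum_even_add_odd (f := fun n : ℕ => 1 / (n : ℝ) ^ (k + 1))
    (hS.comp_injective (i := fun n : ℕ => 2 * n) fun a b h => by simpa using h) hodd
  simp only [heven, tsum_mul_left] at h1
  have h2 := hodd.tsum_eq_zero_add
  have h3 : ∑' n : ℕ, 1 / ((2 * (n + 1) + 1 : ℕ) : ℝ) ^ (k + 1) = oddSum k := by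
    refine tsum_congr fun n => ?_
    push_cast
    congr 2
    ring
  rw [h3] at h2
  have h4 : (2 : ℝ) ^ (-(k : ℤ) - 1) = 1 / 2 ^ (k + 1) := by
    rw [show -(k : ℤ) - 1 = -((k + 1 : ℕ) : ℤ) by push_cast; ring, zpow_neg, zpow_natCast, one_div]
  simp only [mul_zero, zero_add, Nat.cast_one, one_pow, div_one] at h2
  rw [hz, h4]
  linarith

/-! ### The binomial series -/

/-- The coefficient `Γ(x + k + 1) / ((k + 1)! Γ(x))`. -/
def binomCoeff (x : ℝ) (k : ℕ) : ℝ := gammaQuot x k / (k + 1).factorial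

theorem binomCoeff_zero (x : ℝ) : binomCoeff x 0 = x := by simp [binomCoeff, gammaQuot]

theorem binomCoeff_pos {x : ℝ} (hx : 0 < x) (k : ℕ) : 0 < binomCoeff x k :=
  div_pos (Finset.prod_pos fun j _ => by positivity) (by positivity)

theorem binomCoeff_succ (x : ℝ) (k : ℕ) :
    binomCoeff x (k + 1) = binomCoeff x k * ((x + (k + 1)) / (k + 2)) := by
  simp only [binomCoeff, gammaQuot, Finset.prod_range_succ _ (k + 1), Nat.factorial_succ (k + 1)]
  push_cast
  field_simp
  ring

/-- The parameter `|x| + 1` is positive, so the majorant never vanishes and admits the ratio test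
even when `x` is a non-positive integer. -/
theorem abs_binomCoeff_le (x : ℝ) (k : ℕ) : |binomCoeff x k| ≤ binomCoeff (|x| + 1) k := by
  rw [binomCoeff, binomCoeff, abs_div, Nat.abs_cast, gammaQuot, gammaQuot, Finset.abs_prod]
  gcongr with j _
  refine (abs_add_le _ _).trans ?_
  rw [Nat.abs_cast]
  linarith

theorem summable_abs_binomCoeff_mul_pow (x : ℝ) {t : ℝ} (ht0 : 0 ≤ t) (ht : t < 1) :
    Summable fun k => |binomCoeff x k| * t ^ k := by
  rcases ht0.eq_or_lt with rfl | ht0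
  · rw [← summable_nat_add_iff 1]
    simp
  · have hy : 0 < |x| + 1 := by positivity
    refine Summable.of_nonneg_of_le (f := fun k => binomCoeff (|x| + 1) k * t ^ k)
      (fun k => by positivity) (fun k => by gcongr; exact abs_binomCoeff_le x k) ?_
    have hpos : ∀ k, 0 < binomCoeff (|x| + 1) k * t ^ k := fun k =>
      mul_pos (binomCoeff_pos hy k) (pow_pos ht0 k)
    refine summable_of_ratio_test_tendsto_lt_one ht
      (Eventually.of_forall fun k => (hpos k).ne') ?_
    have hlim : Tendsto (fun k : ℕ => (1 + |x| / (k + 2 : ℝ)) * t) atTop (𝓝 t) := by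
      have h1 : Tendsto (fun k : ℕ => (k + 2 : ℝ)) atTop atTop :=
        tendsto_atTop_add_const_right _ _ tendsto_natCast_atTop_atTop
      simpa using ((h1.const_div_atTop |x|).const_add 1).mul_const t
    refine hlim.congr fun k => ?_
    rw [Real.norm_of_nonneg (hpos _).le, Real.norm_of_nonneg (hpos _).le, binomCoeff_succ]
    have := (binomCoeff_pos hy k).ne'
    field_simp
    ring

theorem choose_neg_eq (x : ℝ) (n : ℕ) :
    Ring.choose (-(x : ℂ)) n * n.factorial = (-1) ^ n * ∏ j ∈ Finset.range n, ((x : ℂ) + j) := by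
  have h : (descPochhammer ℤ n).smeval (-(x : ℂ)) =
      (-1) ^ n * ∏ j ∈ Finset.range n, ((x : ℂ) + j) := by
    induction n with
    | zero => simp
    | succ n ih =>
      rw [descPochhammer_succ_right, Polynomial.smeval_mul, ih, Finset.prod_range_succ]
      simp [Polynomial.smeval_natCast]
      ring
  rw [← h, Ring.descPochhammer_eq_factorial_smul_choose, nsmul_eq_mul, mul_comm]

theorem hasSum_zeroTerm (x : ℝ) {τ : ℝ} {w : ℂ} (h : |τ| < ‖w‖) :
    HasSum (fun k : ℕ => -((binomCoeff x k : ℂ) * τ ^ (k + 1) * (1 / w ^ (k + 1))))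
      (zeroTerm x τ w) := by
  have hw : w ≠ 0 := norm_pos_iff.mp ((abs_nonneg _).trans_lt h)
  set u : ℂ := τ / w
  have hu : ‖u‖ < 1 := by
    rw [norm_div, Complex.norm_real, Real.norm_eq_abs, div_lt_one (norm_pos_iff.mpr hw)]
    exact h
  have hre : 0 < (1 - u).re := by
    have := (Complex.abs_re_le_norm u).trans_lt hu
    rw [Complex.sub_re, Complex.one_re]
    linarith [(abs_lt.mp this).2]
  have hbase : w / (w - τ) = (1 - u)⁻¹ := by
    have : 1 - u = (w - τ) / w := by simp only [u]; field_simp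
    rw [this, inv_div]
  have hpow : (w / (w - τ)) ^ (x : ℂ) = (1 + -u) ^ (-(x : ℂ)) := by
    -- Since `1 - u` has positive real part, inversion is compatible with the principal branch.
    rw [hbase, Complex.inv_cpow _ _ (Complex.slitPlane_arg_ne_pi (Or.inl hre)), Complex.cpow_neg,
      sub_eq_add_neg]
  have hs := (Complex.one_add_cpow_hasFPowerSeriesOnBall_zero (a := -(x : ℂ))).hasSum
    (y := -u) (by
      rw [← ENNReal.ofReal_one, Metric.eball_ofReal]
      simpa using hu)
  simp only [zero_add, binomialSeries_apply, smul_eq_mul] at hs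
  have hs' : HasSum (fun n : ℕ => Ring.choose (-(x : ℂ)) n * (-u) ^ n)
      ((1 + -u) ^ (-(x : ℂ))) := by
    refine hs.congr_fun fun n => ?_
    simp
  rw [← hasSum_nat_add_iff' 1] at hs'
  simp only [Finset.sum_range_one, Ring.choose_zero_right, pow_zero, mul_one] at hs'
  rw [zeroTerm, hpow, ← neg_sub]
  refine hs'.neg.congr_fun fun k => ?_
  have hc := choose_neg_eq x (k + 1)
  have hkf : ((k + 1).factorial : ℂ) ≠ 0 := by exact_mod_cast (k + 1).factorial_ne_zero
  rw [← eq_div_iff hkf] at hc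
  have h2 : ((-1 : ℂ) ^ (k + 1)) * (-1) ^ (k + 1) = 1 := by rw [← mul_pow]; simp
  rw [hc, neg_pow u, binomCoeff, gammaQuot, div_pow]
  push_cast
  linear_combination ((∏ j ∈ Finset.range (k + 1), ((x : ℂ) + j)) / (k + 1).factorial *
    (τ ^ (k + 1) / w ^ (k + 1))) * h2

/-! ### The series `P` and `N` -/

theorem termP_eq (x τ : ℝ) {k : ℕ} (hk : 1 ≤ k) :
    termP x τ k = binomCoeff x k * oddSum k * τ ^ k := by
  rw [termP, oddSum_eq hk, binomCoeff]
  ring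

theorem termN_eq (x τ : ℝ) (k : ℕ) :
    termN x τ k = binomCoeff x k * ((-1) ^ k * eta k) * τ ^ k := by
  rw [termN, binomCoeff]
  ring

theorem abs_coeff_mul_le {x τ t a C : ℝ} {k : ℕ} (hτ : |τ| ≤ t)
    (ha : |a| ≤ C * (1 / 3 ^ (k + 1))) :
    |binomCoeff x k * a * τ ^ k| ≤ C * (|binomCoeff x k| * (t / 3) ^ k) := by
  have h0 : 0 ≤ C * (1 / 3 ^ (k + 1)) := (abs_nonneg a).trans ha
  have hC : 0 ≤ C := nonneg_of_mul_nonneg_left h0 (by positivity)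
  have h1 : (1 : ℝ) / 3 ^ (k + 1) ≤ 1 / 3 ^ k := by
    gcongr
    · norm_num
    · lia
  rw [abs_mul, abs_mul, abs_pow]
  calc _ ≤ |binomCoeff x k| * (C * (1 / 3 ^ k)) * t ^ k := by
        gcongr
        exact ha.trans (by gcongr)
    _ = _ := by rw [div_pow]; ring

theorem abs_termP_le {x τ t : ℝ} (hτ : |τ| ≤ t) (k : ℕ) :
    |termP x τ (k + 1)| ≤ 9 * oddSum 1 * (|binomCoeff x (k + 1)| * (t / 3) ^ (k + 1)) := by
  have hk : 1 ≤ k + 1 := by lia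
  rw [termP_eq x τ hk]
  refine abs_coeff_mul_le hτ ?_
  rw [abs_of_pos (oddSum_pos hk)]
  exact oddSum_le hk

theorem abs_termN_le {x τ t : ℝ} (hτ : |τ| ≤ t) (k : ℕ) :
    |termN x τ (k + 1)| ≤
      (9 * oddSum 1 + 1) * (|binomCoeff x (k + 1)| * (t / 3) ^ (k + 1)) := by
  rw [termN_eq x τ]
  refine abs_coeff_mul_le hτ ?_
  rw [abs_mul, abs_pow, abs_neg, abs_one, one_pow, one_mul]
  exact abs_eta_le (by lia)

theorem summable_majorant (x C : ℝ) {t : ℝ} (ht0 : 0 ≤ t) (ht : t < 3) :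
    Summable fun k => C * (|binomCoeff x (k + 1)| * (t / 3) ^ (k + 1)) :=
  ((summable_nat_add_iff 1).mpr
    (summable_abs_binomCoeff_mul_pow x (by positivity : 0 ≤ t / 3) (by linarith))).mul_left C

theorem summable_termP (x : ℝ) {τ : ℝ} (hτ : |τ| < 3) :
    Summable fun k => termP x τ (k + 1) :=
  Summable.of_norm_bounded (summable_majorant x _ (abs_nonneg τ) hτ) fun k => abs_termP_le le_rfl k

theorem summable_termN (x : ℝ) {τ : ℝ} (hτ : |τ| < 3) :
    Summable fun k => termN x τ (k + 1) :=
  Summable.of_norm_bounded (summable_majorant x _ (abs_nonneg τ) hτ) fun k => abs_termN_le le_rfl k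

theorem tendsto_tsum_zero_of_le {u : ℝ → ℕ → ℝ} {x C : ℝ}
    (hu : ∀ k, Continuous fun τ => u τ k)
    (hC : ∀ τ, |τ| ≤ 1 → ∀ k, |u τ k| ≤ C * (|binomCoeff x (k + 1)| * (1 / 3) ^ (k + 1))) :
    Tendsto (fun τ => ∑' k, u τ k) (𝓝[≠] 0) (𝓝 (∑' k, u 0 k)) := by
  refine tendsto_tsum_of_dominated_convergence (summable_majorant x C zero_le_one (by norm_num))
    (fun k => ((hu k).tendsto 0).mono_left nhdsWithin_le_nhds) ?_
  have h : ∀ᶠ τ : ℝ in 𝓝 0, |τ| ≤ 1 := by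
    filter_upwards [closedBall_mem_nhds (0 : ℝ) one_pos] with τ hτ
    simpa using hτ
  exact (h.filter_mono nhdsWithin_le_nhds).mono fun τ hτ k => hC τ hτ k

theorem tendsto_P (x : ℝ) : Tendsto (fun τ => P x τ) (𝓝[≠] 0) (𝓝 (P x 0)) :=
  tendsto_tsum_zero_of_le (fun k => by unfold termP; fun_prop) fun _ hτ k => abs_termP_le hτ k

theorem tendsto_N (x : ℝ) : Tendsto (fun τ => N x τ) (𝓝[≠] 0) (𝓝 (N x 0)) :=
  (tendsto_tsum_zero_of_le (fun k => by unfold termN; fun_prop)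
    fun _ hτ k => abs_termN_le hτ k).const_add _

theorem P_pos {x τ : ℝ} (hx : 0 < x) (h0 : 0 < τ) (h3 : τ < 3) : 0 < P x τ := by
  have hpos : ∀ k, 0 < termP x τ (k + 1) := fun k => by
    have hk : 1 ≤ k + 1 := by lia
    rw [termP_eq x τ hk]
    exact mul_pos (mul_pos (binomCoeff_pos hx _) (oddSum_pos hk)) (pow_pos h0 _)
  exact (summable_termP x (by rwa [abs_of_pos h0])).tsum_pos (fun k => (hpos k).le) 0 (hpos 0)

theorem N_neg {x τ : ℝ} (hx : 0 < x) (h0 : 0 < τ) (h3 : τ < 3) : N x τ < 0 := by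
  have hneg : ∀ k, 0 < -termN x τ (k + 1) := fun k => by
    have hk : 1 ≤ k + 1 := by lia
    have := mul_pos (mul_pos (binomCoeff_pos hx (k + 1))
      (neg_pos.mpr (neg_one_pow_mul_eta_neg hk))) (pow_pos h0 (k + 1))
    rw [termN_eq x τ]
    linarith
  have h1 := (summable_termN x (τ := τ) (by rwa [abs_of_pos h0])).neg.tsum_pos
    (fun k => (hneg k).le) 0 (hneg 0)
  rw [tsum_neg] at h1
  -- The linear term of `N` is `-(liConst * x)`.
  have h2 : 0 ≤ liConst * x := mul_nonneg liConst_nonneg hx.le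
  rw [liConst] at h2
  rw [N]
  linarith

/-! ### Expansion of the sum over the zeros -/

/-- The contribution of a zero and of the `k`-th term of the binomial series. -/
def doubleTerm (x τ : ℝ) (p : NontrivialZeros × ℕ) : ℂ :=
  -(binomCoeff x p.2 * τ ^ (p.2 + 1) / 2) *
    ((zeroMult p.1 : ℂ) * (1 / (p.1 : ℂ) ^ (p.2 + 1) + 1 / (1 - (p.1 : ℂ)) ^ (p.2 + 1)))

theorem hasSum_doubleTerm_row (x : ℝ) {τ : ℝ} (hτ : |τ| < 3) (ρ : NontrivialZeros) :
    HasSum (fun k => doubleTerm x τ (ρ, k)) (pairedTerm x τ ρ) := by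
  have h3 := three_lt_abs_im ρ
  have h1 := hasSum_zeroTerm x (τ := τ) (w := ρ)
    (by linarith [Complex.abs_im_le_norm (ρ : ℂ)])
  have h2 := hasSum_zeroTerm x (τ := τ) (w := 1 - ρ)
    (by linarith [im_abs_le_norm_one_sub ρ])
  refine (((h1.add h2).div_const 2).mul_left (zeroMult ρ : ℂ)).congr_fun fun k => ?_
  simp only [doubleTerm]
  ring

/-- For `k ≥ 1` the two powers are bounded separately, each with constant 9; for `k = 0` only their
sum decays quadratically. -/
theorem norm_zeroMult_mul_inv_pow_add_le (ρ : NontrivialZeros) (k : ℕ) :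
    ‖(zeroMult ρ : ℂ) * (1 / (ρ : ℂ) ^ (k + 1) + 1 / (1 - (ρ : ℂ)) ^ (k + 1))‖ ≤
      (zeroMult ρ : ℝ) / (ρ : ℂ).im ^ 2 * (18 / 3 ^ (k + 1)) := by
  rcases k.eq_zero_or_pos with rfl | hk
  · have h := norm_mult_inv_add_inv_le ρ
    have h0 : 0 ≤ (zeroMult ρ : ℝ) / (ρ : ℂ).im ^ 2 := by positivity
    simp only [zero_add, pow_one]
    linarith
  · rw [mul_add]
    refine (norm_add_le _ _).trans ?_
    have h1 := norm_mult_div_pow_le ρ (Complex.abs_im_le_norm (ρ : ℂ)) hk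
    have h2 := norm_mult_div_pow_le ρ (im_abs_le_norm_one_sub ρ) hk
    calc _ ≤ _ := add_le_add h1 h2
      _ = _ := by ring

theorem summable_doubleTerm (x : ℝ) {τ : ℝ} (hτ : |τ| < 3) : Summable (doubleTerm x τ) := by
  have h1 := (summable_abs_binomCoeff_mul_pow x (t := |τ| / 3) (by positivity)
    (by linarith)).mul_left (3 * |τ|)
  refine Summable.of_norm_bounded (summable_mult_div_im_sq.mul_of_nonneg h1
    (fun ρ => by positivity) fun k => by positivity) fun p => ?_
  have h2 := norm_zeroMult_mul_inv_pow_add_le p.1 p.2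
  rw [doubleTerm, norm_mul, norm_neg, norm_div, norm_mul, norm_pow, Complex.norm_real,
    Complex.norm_real, Real.norm_eq_abs, Real.norm_eq_abs, Complex.norm_ofNat]
  calc _ ≤ |binomCoeff x p.2| * |τ| ^ (p.2 + 1) / 2 *
        ((zeroMult p.1 : ℝ) / (p.1 : ℂ).im ^ 2 * (18 / 3 ^ (p.2 + 1))) := by gcongr
    _ = _ := by
      rw [div_pow]
      field_simp
      ring

/-- The sum of `doubleTerm` over the zeros. -/
def columnSum (x τ : ℝ) : ℕ → ℝ
  | 0 => -(liConst * x * τ)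
  | k + 1 => τ * (termP x τ (k + 1) + termN x τ (k + 1))

theorem hasSum_doubleTerm_column (x τ : ℝ) (k : ℕ) :
    HasSum (fun ρ => doubleTerm x τ (ρ, k)) (columnSum x τ k : ℂ) := by
  cases k with
  | zero =>
    have h := hasSum_inv_add_inv.mul_left (-((binomCoeff x 0 : ℂ) * τ ^ (0 + 1) / 2))
    have e : ((columnSum x τ 0 : ℝ) : ℂ) =
        -((binomCoeff x 0 : ℂ) * τ ^ (0 + 1) / 2) * (2 * liConst) := by
      simp only [columnSum, binomCoeff_zero]
      push_cast
      ring
    rw [e]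
    refine h.congr_fun fun ρ => ?_
    simp only [doubleTerm, zero_add, pow_one]
  | succ k =>
    have hk : 1 ≤ k + 1 := by lia
    have h1 := hasSum_inv_pow hk
    have h2 := hasSum_inv_one_sub_pow hk
    rw [iteratedDeriv_logDeriv_xi hk] at h1 h2
    have h := (h1.add h2).mul_left (-((binomCoeff x (k + 1) : ℂ) * τ ^ (k + 1 + 1) / 2))
    have e : ((columnSum x τ (k + 1) : ℝ) : ℂ) =
        -((binomCoeff x (k + 1) : ℂ) * τ ^ (k + 1 + 1) / 2) *
          (((-(oddSum (k + 1) + (-1) ^ (k + 1) * eta (k + 1)) : ℝ) : ℂ) +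
            ((-(oddSum (k + 1) + (-1) ^ (k + 1) * eta (k + 1)) : ℝ) : ℂ)) := by
      simp only [columnSum, termP_eq x τ hk, termN_eq]
      push_cast
      ring
    rw [e]
    refine h.congr_fun fun ρ => ?_
    simp only [doubleTerm]
    ring

theorem hasSum_columnSum (x : ℝ) {τ : ℝ} (hτ : |τ| < 3) :
    HasSum (columnSum x τ) (τ * (P x τ + N x τ)) := by
  have h := ((summable_termP x hτ).hasSum.add (summable_termN x hτ).hasSum).mul_left τ
  have e : τ * (P x τ + N x τ) - columnSum x τ 0 =
      τ * (∑' k, termP x τ (k + 1) + ∑' k, termN x τ (k + 1)) := by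
    simp only [columnSum, P, N, liConst]
    ring
  rw [← hasSum_nat_add_iff' 1, Finset.sum_range_one, e]
  exact h

/-- Fubini for `doubleTerm`: rows are the binomial expansions of the paired terms, columns the power
sums over the zeros. -/
theorem hasSum_pairedTerm (x : ℝ) {τ : ℝ} (hτ : |τ| < 3) :
    HasSum (pairedTerm x τ) ((τ * (P x τ + N x τ) : ℝ) : ℂ) := by
  have hT := (summable_doubleTerm x hτ).hasSum
  have hrows := hT.prod_fiberwise (hasSum_doubleTerm_row x hτ)
  have hcols := ((Equiv.prodComm ℕ NontrivialZeros).hasSum_iff.mpr hT).prod_fiberwise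
    (hasSum_doubleTerm_column x τ)
  rw [← hcols.unique (Complex.hasSum_ofReal.mpr (hasSum_columnSum x hτ))]
  exact hrows

theorem F_eq (x : ℝ) {τ : ℝ} (hτ : |τ| < 3) (h0 : τ ≠ 0) :
    F x τ = ((P x τ + N x τ : ℝ) : ℂ) := by
  have : (τ : ℂ) ≠ 0 := by exact_mod_cast h0
  rw [F, (hasSum_pairedTerm x hτ).tsum_eq, Complex.ofReal_mul, one_div,
    inv_mul_cancel_left₀ this]

theorem tendsto_F (x : ℝ) :
    Tendsto (fun τ : ℝ => F x τ) (𝓝[≠] 0) (𝓝 ((P x 0 + N x 0 : ℝ) : ℂ)) := by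
  have h := (Complex.continuous_ofReal.tendsto _).comp ((tendsto_P x).add (tendsto_N x))
  refine h.congr' ?_
  filter_upwards [self_mem_nhdsWithin,
    nhdsWithin_le_nhds (ball_mem_nhds (0 : ℝ) (by norm_num : (0 : ℝ) < 3))] with τ h0 hτ
  exact (F_eq x (by simpa using hτ) h0).symm

end LiType

end

theorem corollary5p3 :
    -- both series converge for `|τ| < 3`, so does the sum over the zeros, and `F = P + N`
    (∀ x τ : ℝ, |τ| < 3 →
      Summable (fun k : ℕ => LiType.termP x τ (k + 1)) ∧
      Summable (fun k : ℕ => LiType.termN x τ (k + 1)) ∧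
      Summable (LiType.pairedTerm x τ) ∧
      (τ ≠ 0 → LiType.F x τ = ((LiType.P x τ + LiType.N x τ : ℝ) : ℂ))) ∧
    -- at `τ = 0`, where `F` is given by its limit
    (∀ x : ℝ, Tendsto (fun τ : ℝ => LiType.F x τ) (𝓝[≠] 0)
      (𝓝 ((LiType.P x 0 + LiType.N x 0 : ℝ) : ℂ))) ∧
    -- signs
    (∀ x τ : ℝ, 0 < x → 0 < τ → τ < 3 → 0 < LiType.P x τ ∧ LiType.N x τ < 0) := by
  refine ⟨fun x τ hτ => ⟨LiType.summable_termP x hτ, LiType.summable_termN x hτ,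
    (LiType.hasSum_pairedTerm x hτ).summable, LiType.F_eq x hτ⟩, LiType.tendsto_F,
    fun x τ hx h0 h3 => ⟨LiType.P_pos hx h0 h3, LiType.N_neg hx h0 h3⟩⟩
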